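/- Let $K$ be a number field, and write $\mathbb A_K$ for its (full) adele ring. For a rational prime $p$, the splitting type of $p$ in $K$ is the unordered list, with repetitions, of the residue degrees of the distinct primes of $\mathcal O_K$ above $p$. Call two number fields $K$ and $L$ arithmetically equivalent if all but finitely many rational primes $p$ have the same splitting type in $K$ and in $L$. Then, up to isomorphism of fields, 1. there are only finitely many number fields $L$ such that the rings $\mathbb A_K$ and $\mathbb A_L$ are elementarily equivalent, i.e. satisfy the same first-order sentences in the language of rings; 2. more generally, there are only finitely many number fields $L$ that are arithmetically equivalent to $K$. -/

import Mathlib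

/-- Two commutative rings are elementarily equivalent: they satisfy the same first-order sentences
in the language of rings `{+, *, -, 0, 1}`, each ring carrying its own operations. -/
def RingElementarilyEquivalent (R S : Type*) [CommRing R] [CommRing S] : Prop :=
  letI := FirstOrder.Ring.compatibleRingOfRing R
  letI := FirstOrder.Ring.compatibleRingOfRing S
  FirstOrder.Language.ring.ElementarilyEquivalent R S

/-- The splitting type of a rational prime `p` in a number field `K`: the unordered list (with
repetitions) of the residue degrees of the distinct primes of the ring of integers above `p`. -/
noncomputable def splittingType (K : Type*) [Field K] [NumberField K] (p : ℕ) : Multiset ℕ :=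
  (IsDedekindDomain.primesOverFinset (Ideal.span {(p : ℤ)})
    (NumberField.RingOfIntegers K)).val.map
      fun P => P.inertiaDeg ℤ

/-- Two number fields are arithmetically equivalent: all but finitely many rational primes have
the same splitting type in both. -/
def ArithmeticallyEquivalent (K L : Type*) [Field K] [NumberField K] [Field L] [NumberField L] :
    Prop :=
  {p : ℕ | p.Prime ∧ splittingType K p ≠ splittingType L p}.Finite

/-!
Both parts follow from one statement: if almost all rational primes `p` have equally many primes
above them in `K` and in `L`, then `L` embeds into the normal closure of `K`, which has only
finitely many subfields (`PrimesAboveCardEquivalent.exists_ringEquiv`,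
`finite_setOf_le_normalClosure`). Arithmetically equivalent fields satisfy this hypothesis, since
the number of primes above `p` is the length of the splitting type.

The embedding is a theorem of Bauer's kind. A prime splits completely in a number field when the
number of primes above it is the degree. Some prime splits completely in a Galois extension
containing both fields, so `K` and `L` have the same degree, and therefore the same completely split
primes up to finitely many. Let `N` be the normal closure of `K`. Almost all primes that split
completely in `N` do so in `K`, hence in `L`, hence in the compositum `N L`. For a Galois field
`N`, the Euler product of the zeta function over the completely split primes accounts for the whole
pole at `1`, and for `N L` it accounts for at most that pole. Comparing the orders of the poles
gives `[N L : ℚ] ≤ [N : ℚ]`, that is, `L ⊆ N` (`finrank_le_of_finite_splitPrimes_diff`). The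
analytic input is the class number formula. All Euler products are taken in `ℝ≥0∞`, where
convergence is no issue.

That elementarily equivalent adele rings satisfy the hypothesis is seen by counting minimal
idempotents. These correspond to the places of `K`, and the component at a place is a completion
of `K`. For an odd prime `p`, the places above `p` are those where, for some `t`, the set of all
`x` with `1 + t x²` a square is closed under addition and contains `1` but not `p⁻¹`
(`DetectsPrime`). If `t` is a uniformizer at a place above `p`, this set is the valuation ring. At
any other place the set contains a neighborhood of `0`, and `p⁻¹` is the sum of a natural number
and a natural multiple of an arbitrarily small element, so no such `t` exists. The sentences saying
that at least `m` minimal idempotents detect `p` thus determine the number of primes above `p`.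
-/

open NumberField
open IsDedekindDomain Filter Topology
open scoped ENNReal

/-! ### Primes above a rational prime and trivial residue field extensions -/

/-- The number of primes of the ring of integers of `K` above the rational prime `p`. -/
noncomputable def primesAboveCard (K : Type*) [Field K] [NumberField K] (p : ℕ) : ℕ :=
  (IsDedekindDomain.primesOverFinset (Ideal.span {(p : ℤ)}) (𝓞 K)).card

/-- All residue fields of `K` above `p` are prime fields, stated through the triviality of the
Frobenius map so that it passes easily between rings of integers. -/
def ResidueFieldsTrivial (K : Type*) [Field K] [NumberField K] (p : ℕ) : Prop :=
  ∀ Q : Ideal (𝓞 K), Q.IsPrime → (p : 𝓞 K) ∈ Q → ∀ x : 𝓞 K, x ^ p - x ∈ Q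

section
variable {K : Type*} [Field K] [NumberField K] {p : ℕ}

theorem mem_primesOverFinset_iff_mem (hp : p.Prime) {Q : Ideal (𝓞 K)} :
    Q ∈ IsDedekindDomain.primesOverFinset (Ideal.span {(p : ℤ)}) (𝓞 K) ↔
      Q.IsPrime ∧ (p : 𝓞 K) ∈ Q := by
  have hp' : Prime (p : ℤ) := Nat.prime_iff_prime_int.mp hp
  have : (Ideal.span {(p : ℤ)}).IsMaximal :=
    PrincipalIdealRing.isMaximal_of_irreducible hp'.irreducible
  rw [IsDedekindDomain.mem_primesOverFinset_iff (by simpa using hp.ne_zero), Ideal.primesOver]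
  refine and_congr_right fun hQ => ?_
  rw [Ideal.liesOver_span_iff hQ.ne_top hp']
  simp

/-- The residue field has `p` elements exactly when all its elements are roots of `X ^ p - X`. -/
theorem inertiaDeg_eq_one_iff_forall_pow_sub_mem (hp : p.Prime) {Q : Ideal (𝓞 K)} [Q.IsPrime]
    (hQ : (p : 𝓞 K) ∈ Q) : Q.inertiaDeg ℤ = 1 ↔ ∀ x : 𝓞 K, x ^ p - x ∈ Q := by
  have hp' : Prime (p : ℤ) := Nat.prime_iff_prime_int.mp hp
  have : Q.LiesOver (Ideal.span {(p : ℤ)}) :=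
    (Ideal.liesOver_span_iff (Ideal.IsPrime.ne_top ‹_›) hp').mpr (by simpa using hQ)
  have hcard : p ^ Q.inertiaDeg ℤ = Nat.card (𝓞 K ⧸ Q) := Ideal.pow_inertiaDeg p Q
  have hQ0 : Q ≠ ⊥ := by
    rintro rfl
    exact hp.ne_zero (by simpa using hQ)
  have : Q.IsMaximal := Ideal.IsPrime.isMaximal ‹_› hQ0
  let : Field (𝓞 K ⧸ Q) := Ideal.Quotient.field Q
  have : Finite (𝓞 K ⧸ Q) := Q.finiteQuotientOfFreeOfNeBot hQ0
  let := Fintype.ofFinite (𝓞 K ⧸ Q)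
  constructor
  · intro h x
    rw [h, pow_one, Nat.card_eq_fintype_card] at hcard
    rw [← Ideal.Quotient.eq, map_pow]
    conv_lhs => rw [hcard]
    exact FiniteField.pow_card _
  · intro h
    have hroot : (Polynomial.X ^ p - Polynomial.X : Polynomial (𝓞 K ⧸ Q)) ≠ 0 :=
      FiniteField.X_pow_card_sub_X_ne_zero _ hp.one_lt
    have hle : Nat.card (𝓞 K ⧸ Q) ≤ p := by
      rw [Nat.card_eq_fintype_card, ← Finset.card_univ]
      refine (Polynomial.card_le_degree_of_subset_roots
        (p := (Polynomial.X ^ p - Polynomial.X : Polynomial (𝓞 K ⧸ Q))) ?_).trans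
        (FiniteField.X_pow_card_sub_X_natDegree_eq _ hp.one_lt).le
      intro x _
      obtain ⟨x, rfl⟩ := Ideal.Quotient.mk_surjective x
      rw [Polynomial.mem_roots hroot]
      simpa [sub_eq_zero, ← map_pow, Ideal.Quotient.eq] using h x
    rw [← hcard] at hle
    have h1 : Q.inertiaDeg ℤ ≤ 1 := by
      by_contra! hlt
      exact absurd hle (not_le.mpr (by simpa using Nat.pow_lt_pow_right hp.one_lt hlt))
    have := Ideal.inertiaDeg_pos Q ℤ
    omega

/-- The fundamental identity `∑ e f = n` for the primes above `p`. -/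
theorem sum_ramificationIdx_mul_inertiaDeg (hp : p.Prime) :
    ∑ Q ∈ IsDedekindDomain.primesOverFinset (Ideal.span {(p : ℤ)}) (𝓞 K),
      Q.ramificationIdx ℤ * Q.inertiaDeg ℤ = Module.finrank ℚ K := by
  have hp' : Prime (p : ℤ) := Nat.prime_iff_prime_int.mp hp
  have : (Ideal.span {(p : ℤ)}).IsMaximal :=
    PrincipalIdealRing.isMaximal_of_irreducible hp'.irreducible
  have hset := IsDedekindDomain.coe_primesOverFinset (p := Ideal.span {(p : ℤ)})
    (by simpa using hp.ne_zero) (𝓞 K)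
  have : Finite ((Ideal.span {(p : ℤ)}).primesOver (𝓞 K)) := by
    rw [← hset]; exact Finset.finite_toSet _
  let := Fintype.ofFinite ((Ideal.span {(p : ℤ)}).primesOver (𝓞 K))
  rw [← RingOfIntegers.rank K,
    ← Ideal.sum_ramification_inertia_eq_finrank (Ideal.span {(p : ℤ)}) (𝓞 K)]
  refine Finset.sum_subtype _ (fun Q => ?_) _
  rw [← hset, Finset.mem_coe]

theorem residueFieldsTrivial_of_primesAboveCard_eq (hp : p.Prime)
    (h : primesAboveCard K p = Module.finrank ℚ K) : ResidueFieldsTrivial K p := by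
  intro Q hQ hpQ
  rw [← inertiaDeg_eq_one_iff_forall_pow_sub_mem hp hpQ]
  have hmem := (mem_primesOverFinset_iff_mem hp).mpr ⟨hQ, hpQ⟩
  rw [← sum_ramificationIdx_mul_inertiaDeg hp, primesAboveCard, Finset.card_eq_sum_ones] at h
  have hpos : ∀ P ∈ IsDedekindDomain.primesOverFinset (Ideal.span {(p : ℤ)}) (𝓞 K),
      1 ≤ P.ramificationIdx ℤ * P.inertiaDeg ℤ := fun P hP => by
    have := ((mem_primesOverFinset_iff_mem hp).mp hP).1
    exact Nat.mul_pos (Ideal.ramificationIdx_pos P ℤ) (Ideal.inertiaDeg_pos P ℤ)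
  exact Nat.eq_one_of_mul_eq_one_left ((Finset.sum_eq_sum_iff_of_le hpos).mp h Q hmem).symm

theorem primesAboveCard_eq_of_forall_inertiaDeg_eq_one (hp : p.Prime)
    (hdisc : ¬ (p : ℤ) ∣ discr K)
    (h : ∀ Q : Ideal (𝓞 K), Q.IsPrime → (p : 𝓞 K) ∈ Q → Q.inertiaDeg ℤ = 1) :
    primesAboveCard K p = Module.finrank ℚ K := by
  have hp' : Prime (p : ℤ) := Nat.prime_iff_prime_int.mp hp
  rw [← sum_ramificationIdx_mul_inertiaDeg hp, primesAboveCard, Finset.card_eq_sum_ones]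
  refine Finset.sum_congr rfl fun Q hQ => ?_
  obtain ⟨hQ, hpQ⟩ := (mem_primesOverFinset_iff_mem hp).mp hQ
  have := (not_dvd_discr_iff_forall_mem K (𝓞 K) hp').mp hdisc Q hQ (by simpa using hpQ)
  rw [Ideal.ramificationIdx_eq_one, h Q hQ hpQ]

theorem ResidueFieldsTrivial.primesAboveCard_eq (hp : p.Prime)
    (h : ResidueFieldsTrivial K p) (hdisc : ¬ (p : ℤ) ∣ discr K) :
    primesAboveCard K p = Module.finrank ℚ K :=
  primesAboveCard_eq_of_forall_inertiaDeg_eq_one hp hdisc fun Q hQ hpQ =>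
    (inertiaDeg_eq_one_iff_forall_pow_sub_mem hp hpQ).mpr (h Q hQ hpQ)

theorem finite_setOf_dvd {d : ℤ} (hd : d ≠ 0) : {p : ℕ | (p : ℤ) ∣ d}.Finite :=
  (Set.finite_Iic d.natAbs).subset fun _ hp =>
    Nat.le_of_dvd (Int.natAbs_pos.mpr hd) (Int.natCast_dvd.mp hp)

/-- Only the ramified primes can have all residue degrees one without splitting completely. -/
theorem finite_residueFieldsTrivial_and_primesAboveCard_ne (K : Type*) [Field K] [NumberField K] :
    {p : ℕ | p.Prime ∧ ResidueFieldsTrivial K p ∧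
      primesAboveCard K p ≠ Module.finrank ℚ K}.Finite :=
  (finite_setOf_dvd (discr_ne_zero K)).subset fun _ ⟨hp, h, hne⟩ => by
    by_contra hdisc
    exact hne (h.primesAboveCard_eq hp hdisc)

theorem ResidueFieldsTrivial.of_ringHom {M : Type*} [Field M] [NumberField M] (f : K →+* M)
    (h : ResidueFieldsTrivial M p) : ResidueFieldsTrivial K p := by
  let := (RingOfIntegers.mapRingHom f).toAlgebra
  have hinj : Function.Injective (algebraMap (𝓞 K) (𝓞 M)) := fun x y hxy => by
    have := congrArg (algebraMap (𝓞 M) M) hxy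
    exact RingOfIntegers.ext (f.injective this)
  have : Algebra.IsIntegral (𝓞 K) (𝓞 M) :=
    Algebra.IsIntegral.tower_top ℤ
  intro P hP hpP x
  obtain ⟨Q, hPQ, hQ⟩ := Ideal.exists_ideal_over_prime_of_isIntegral_of_isDomain (S := 𝓞 M) P
    (by rw [(RingHom.injective_iff_ker_eq_bot _).mp hinj]; exact bot_le)
  rw [← hQ, Ideal.mem_comap, map_sub, map_pow]
  rw [← hQ, Ideal.mem_comap, map_natCast] at hpP
  exact h Q hPQ hpP _
end

section
variable {K L M : Type*} [Field K] [NumberField K] [Field L] [NumberField L]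
  [Field M] [NumberField M]

theorem exists_intCast_mul_eq_mapRingHom {F E : Type*} [Field F] [NumberField F] [Field E]
    (f : F →+* E) (y : F) :
    ∃ d : ℤ, d ≠ 0 ∧ ∃ b ∈ (RingOfIntegers.mapRingHom f).range,
      (d : E) * f y = algebraMap (𝓞 E) E b := by
  have hy : IsAlgebraic ℤ y :=
    (IsFractionRing.isAlgebraic_iff ℤ ℚ F).mpr (Algebra.IsAlgebraic.isAlgebraic y)
  obtain ⟨d, hd, hy⟩ := hy.exists_integral_multiple
  refine ⟨d, hd, _, ⟨⟨d • y, hy⟩, rfl⟩, ?_⟩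
  change (d : E) * f y = f (d • y)
  simp

/-- The compositum of the rings of integers has finite exponent in the ring of integers of the
compositum. -/
theorem exists_intCast_mul_mem_sup_range (f : K →+* M) (g : L →+* M)
    (hfg : f.fieldRange ⊔ g.fieldRange = ⊤) :
    ∃ d : ℤ, d ≠ 0 ∧ ∀ x : 𝓞 M, (d : 𝓞 M) * x ∈
      (RingOfIntegers.mapRingHom f).range ⊔ (RingOfIntegers.mapRingHom g).range := by
  set B := (RingOfIntegers.mapRingHom f).range ⊔ (RingOfIntegers.mapRingHom g).range
  -- the fractions with numerator in `B` and denominator a rational integer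
  let C : Subalgebra ℚ M :=
    { carrier := {x | ∃ d : ℤ, d ≠ 0 ∧ ∃ b ∈ B, (d : M) * x = algebraMap (𝓞 M) M b}
      mul_mem' := by
        rintro x y ⟨d, hd, b, hb, h⟩ ⟨d', hd', b', hb', h'⟩
        refine ⟨d * d', mul_ne_zero hd hd', b * b', mul_mem hb hb', ?_⟩
        rw [map_mul, ← h, ← h']; push_cast; ring
      add_mem' := by
        rintro x y ⟨d, hd, b, hb, h⟩ ⟨d', hd', b', hb', h'⟩
        refine ⟨d * d', mul_ne_zero hd hd', d' * b + d * b',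
          add_mem (mul_mem (intCast_mem _ _) hb) (mul_mem (intCast_mem _ _) hb'), ?_⟩
        simp only [map_add, map_mul, ← h, ← h', map_intCast]; push_cast; ring
      algebraMap_mem' := by
        intro r
        refine ⟨r.den, by exact_mod_cast r.den_nz, r.num, intCast_mem _ _, ?_⟩
        rw [map_intCast, eq_ratCast]
        exact_mod_cast congrArg (Rat.cast (K := M)) (Rat.den_mul_eq_num r) }
  -- `C` is a field, because `M` is algebraic over `ℚ`, and it contains both images
  let E : IntermediateField ℚ M := C.toIntermediateField' (Subalgebra.isField_of_algebraic C)
  have hE : E.toSubfield = ⊤ := by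
    rw [eq_top_iff, ← hfg, sup_le_iff]
    constructor
    · rintro _ ⟨y, rfl⟩
      obtain ⟨d, hd, b, hb, h⟩ := exists_intCast_mul_eq_mapRingHom f y
      exact ⟨d, hd, b, le_sup_left (a := (RingOfIntegers.mapRingHom f).range) hb, h⟩
    · rintro _ ⟨y, rfl⟩
      obtain ⟨d, hd, b, hb, h⟩ := exists_intCast_mul_eq_mapRingHom g y
      exact ⟨d, hd, b, le_sup_right (b := (RingOfIntegers.mapRingHom g).range) hb, h⟩
  have hx : ∀ x : 𝓞 M, ∃ d : ℤ, d ≠ 0 ∧ (d : 𝓞 M) * x ∈ B := fun x => by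
    obtain ⟨d, hd, b, hb, h⟩ : (x : M) ∈ E.toSubfield := hE ▸ Subfield.mem_top _
    refine ⟨d, hd, ?_⟩
    convert hb
    apply RingOfIntegers.coe_injective
    rw [← h, map_mul, map_intCast]
  choose e he0 he using hx
  -- a common exponent for a finite set of generators of `𝓞 M`
  obtain ⟨s, hs⟩ := Module.Finite.fg_top (R := ℤ) (M := 𝓞 M)
  refine ⟨∏ x ∈ s, e x, Finset.prod_ne_zero_iff.mpr fun x _ => he0 x, fun x => ?_⟩
  have hxs : x ∈ Submodule.span ℤ (s : Set (𝓞 M)) := hs ▸ Submodule.mem_top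
  induction hxs using Submodule.span_induction with
  | mem x hx =>
    classical
    rw [← Finset.prod_erase_mul _ _ hx, Int.cast_mul, mul_assoc]
    exact mul_mem (intCast_mem _ _) (he x)
  | zero => simp
  | add x y _ _ hx hy => rw [mul_add]; exact add_mem hx hy
  | smul n x _ hx => rw [mul_smul_comm]; exact zsmul_mem hx n

/-- Outside the primes dividing the exponent of `𝓞 M` modulo the compositum of `𝓞 K` and `𝓞 L`,
the Frobenius map is trivial on a residue field of `M` as soon as it is on those of `K` and `L`. -/
theorem finite_residueFieldsTrivial_of_sup_eq_top (f : K →+* M) (g : L →+* M)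
    (hfg : f.fieldRange ⊔ g.fieldRange = ⊤) :
    {p : ℕ | p.Prime ∧ ResidueFieldsTrivial K p ∧ ResidueFieldsTrivial L p ∧
      ¬ ResidueFieldsTrivial M p}.Finite := by
  obtain ⟨d, hd, hB⟩ := exists_intCast_mul_mem_sup_range f g hfg
  refine (finite_setOf_dvd hd).subset fun p ⟨hp, hK, hL, hM⟩ => ?_
  by_contra hpd
  refine hM fun Q hQ hpQ x => ?_
  have := Fact.mk hp
  have : CharP (𝓞 M ⧸ Q) p := by
    rw [CharP.charP_iff_prime_eq_zero hp]
    exact_mod_cast Ideal.Quotient.eq_zero_iff_mem.mpr hpQ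
  -- the elements of `𝓞 M` fixed by Frobenius modulo `Q`
  let A : Subring (𝓞 M) := ((frobenius (𝓞 M ⧸ Q) p).eqLocus (RingHom.id _)).comap
    (Ideal.Quotient.mk Q)
  have hA : ∀ y, y ∈ A ↔ y ^ p - y ∈ Q := fun y => by
    rw [← Ideal.Quotient.eq, map_pow]; rfl
  have hmem : (RingOfIntegers.mapRingHom f).range ⊔ (RingOfIntegers.mapRingHom g).range ≤ A := by
    refine sup_le ?_ ?_
    · rintro _ ⟨y, rfl⟩
      have := hK (Q.comap (RingOfIntegers.mapRingHom f)) (hQ.comap _) (by simpa) y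
      rw [hA, ← map_pow, ← map_sub]
      exact this
    · rintro _ ⟨y, rfl⟩
      have := hL (Q.comap (RingOfIntegers.mapRingHom g)) (hQ.comap _) (by simpa) y
      rw [hA, ← map_pow, ← map_sub]
      exact this
  have hdx := (hA _).mp (hmem (hB x))
  have hd1 := (hA _).mp (intCast_mem A d)
  have hdQ : (d : 𝓞 M) ∉ Q := fun h => hpd <| by
    rw [Set.mem_ofPred_eq, ← CharP.intCast_eq_zero_iff (𝓞 M ⧸ Q)]
    exact_mod_cast Ideal.Quotient.eq_zero_iff_mem.mpr h
  have : (d : 𝓞 M) * (x ^ p - x) ∈ Q := by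
    have := Q.sub_mem hdx (Q.mul_mem_right (x ^ p) hd1)
    convert this using 1
    ring
  exact (hQ.mem_or_mem this).resolve_left hdQ
end

/-! ### Euler products of Dedekind zeta functions -/

section
variable (K : Type*) [Field K] [NumberField K]

/-- The term `N(I)⁻ˢ` of the Dedekind zeta function, as an extended nonnegative real. -/
noncomputable def zetaTerm (s : ℝ) (I : Ideal (𝓞 K)) : ℝ≥0∞ := (Ideal.absNorm I : ℝ≥0∞) ^ (-s)

/-- The Dedekind zeta function at a real point as a sum over the nonzero ideals, with values in
the extended nonnegative reals, where convergence is no issue. -/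
noncomputable def eZeta (s : ℝ) : ℝ≥0∞ := ∑' I : {I : Ideal (𝓞 K) // I ≠ ⊥}, zetaTerm K s I

/-- The nonzero ideals all of whose prime divisors lie in the finite set `T`. -/
def idealsSupportedOn (T : Finset (HeightOneSpectrum (𝓞 K))) : Set (Ideal (𝓞 K)) :=
  {I | I ≠ ⊥ ∧ ∀ v : HeightOneSpectrum (𝓞 K), v.asIdeal ∣ I → v ∈ T}

variable {K}

theorem zetaTerm_mul (s : ℝ) (I J : Ideal (𝓞 K)) (hI : I ≠ ⊥) (hJ : J ≠ ⊥) :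
    zetaTerm K s (I * J) = zetaTerm K s I * zetaTerm K s J := by
  rw [zetaTerm, map_mul, Nat.cast_mul, ENNReal.mul_rpow_of_ne_zero, zetaTerm, zetaTerm]
  · simpa [Ideal.absNorm_eq_zero_iff]
  · simpa [Ideal.absNorm_eq_zero_iff]

theorem zetaTerm_top (s : ℝ) : zetaTerm K s ⊤ = 1 := by
  simp [zetaTerm]

theorem zetaTerm_pow_mul (s : ℝ) (v : HeightOneSpectrum (𝓞 K)) (k : ℕ) (J : Ideal (𝓞 K))
    (hJ : J ≠ ⊥) :
    zetaTerm K s (v.asIdeal ^ k * J) = zetaTerm K s v.asIdeal ^ k * zetaTerm K s J := by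
  induction k with
  | zero => simp
  | succ k ih =>
    rw [pow_succ', mul_assoc, zetaTerm_mul _ _ _ v.ne_bot
      (mul_ne_zero (pow_ne_zero k v.ne_bot) hJ), ih, pow_succ', mul_assoc]

/-- Finite Euler products: splitting off one prime at a time, unique factorization identifies
`I` with a pair consisting of a power of that prime and an ideal prime to it. -/
theorem tsum_idealsSupportedOn (s : ℝ) (T : Finset (HeightOneSpectrum (𝓞 K))) :
    ∑' I : idealsSupportedOn K T, zetaTerm K s I =
      ∏ v ∈ T, (1 - zetaTerm K s v.asIdeal)⁻¹ := by
  classical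
  induction T using Finset.induction_on with
  | empty =>
    have : idealsSupportedOn K ∅ = {⊤} := by
      ext I
      simp only [idealsSupportedOn, Set.mem_ofPred_eq, Set.mem_singleton_iff, Finset.notMem_empty,
        imp_false]
      constructor
      · rintro ⟨h0, h⟩
        by_contra hI
        obtain ⟨P, hP, hIP⟩ := Ideal.exists_le_maximal I hI
        exact h ⟨P, hP.isPrime, fun hb => h0 (le_bot_iff.mp (hb ▸ hIP))⟩ (Ideal.dvd_iff_le.mpr hIP)
      · rintro rfl
        exact ⟨top_ne_bot, fun v hv => v.isPrime.ne_top (top_le_iff.mp (Ideal.dvd_iff_le.mp hv))⟩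
    rw [this, tsum_singleton ⊤ (zetaTerm K s), zetaTerm_top, Finset.prod_empty]
  | insert v T hv ih =>
    rw [Finset.prod_insert hv, ← ih, ← ENNReal.tsum_geometric, ← ENNReal.tsum_mul_right]
    simp_rw [← ENNReal.tsum_mul_left]
    rw [← ENNReal.tsum_prod]
    have hvP : Prime v.asIdeal := v.prime
    have hnd : ∀ J : idealsSupportedOn K T, ¬ v.asIdeal ∣ J := fun J h => hv (J.2.2 v h)
    let φ : ℕ × idealsSupportedOn K T → idealsSupportedOn K (insert v T) := fun x =>
      ⟨v.asIdeal ^ x.1 * x.2, mul_ne_zero (pow_ne_zero _ v.ne_bot) x.2.2.1, fun w hw => by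
        rcases w.prime.dvd_or_dvd hw with h | h
        · have := (w.prime.dvd_prime_iff_associated hvP).mp (w.prime.dvd_of_dvd_pow h)
          exact Finset.mem_insert.mpr (.inl (HeightOneSpectrum.ext (associated_iff_eq.mp this)))
        · exact Finset.mem_insert_of_mem (x.2.2.2 w h)⟩
    have hφ : Function.Bijective φ := by
      constructor
      · have aux : ∀ (k l : ℕ) (I J : idealsSupportedOn K T), k < l →
            v.asIdeal ^ k * (I : Ideal (𝓞 K)) ≠ v.asIdeal ^ l * J := by
          intro k l I J hkl h
          obtain ⟨m, rfl⟩ := Nat.exists_eq_add_of_lt hkl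
          rw [add_assoc, pow_add, mul_assoc] at h
          refine hnd I ?_
          rw [mul_left_cancel₀ (pow_ne_zero k v.ne_bot) h, pow_succ']
          exact (dvd_mul_right _ _).mul_right _
        rintro ⟨k, I⟩ ⟨l, J⟩ h
        have h : v.asIdeal ^ k * (I : Ideal (𝓞 K)) = v.asIdeal ^ l * J := congrArg Subtype.val h
        rcases lt_trichotomy k l with hkl | rfl | hkl
        · exact absurd h (aux k l I J hkl)
        · exact Prod.ext rfl (Subtype.ext (mul_left_cancel₀ (pow_ne_zero k v.ne_bot) h))
        · exact absurd h.symm (aux l k J I hkl)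
      · rintro ⟨I, hI0, hI⟩
        obtain ⟨J, hJ, hvJ⟩ :=
          (FiniteMultiplicity.of_prime_left hvP hI0).exists_eq_pow_mul_and_not_dvd
        have hJI : J ∣ I := Dvd.intro_left _ hJ.symm
        refine ⟨⟨multiplicity v.asIdeal I, J, fun h => hI0 ?_, fun w hw => ?_⟩,
          Subtype.ext hJ.symm⟩
        · rw [hJ, h, ← Ideal.zero_eq_bot, mul_zero]
        · refine (Finset.mem_insert.mp (hI w (hw.trans hJI))).resolve_left ?_
          rintro rfl
          exact hvJ hw
    rw [← (Equiv.ofBijective φ hφ).tsum_eq]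
    refine tsum_congr fun x => ?_
    exact zetaTerm_pow_mul s v x.1 x.2 x.2.2.1

/-- With `eZeta_le`, this says that the zeta function is the supremum of its finite Euler
products. -/
theorem prod_le_eZeta (s : ℝ) (T : Finset (HeightOneSpectrum (𝓞 K))) :
    ∏ v ∈ T, (1 - zetaTerm K s v.asIdeal)⁻¹ ≤ eZeta K s := by
  rw [← tsum_idealsSupportedOn, eZeta]
  exact ENNReal.tsum_mono_subtype (zetaTerm K s) (t := {I | I ≠ ⊥}) fun I hI => hI.1

theorem eZeta_le (s : ℝ) {c : ℝ≥0∞}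
    (h : ∀ T : Finset (HeightOneSpectrum (𝓞 K)),
      ∏ v ∈ T, (1 - zetaTerm K s v.asIdeal)⁻¹ ≤ c) : eZeta K s ≤ c := by
  classical
  rw [eZeta, ENNReal.tsum_eq_iSup_sum]
  refine iSup_le fun F => ?_
  let T : Finset (HeightOneSpectrum (𝓞 K)) :=
    F.biUnion fun I => (Ideal.finite_factors I.2).toFinset
  refine le_trans ?_ (h T)
  rw [← tsum_idealsSupportedOn]
  have hF : ∀ I ∈ F, (I : Ideal (𝓞 K)) ∈ idealsSupportedOn K T := fun I hI =>
    ⟨I.2, fun v hv => Finset.mem_biUnion.mpr ⟨I, hI, by simpa using hv⟩⟩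
  calc ∑ I ∈ F, zetaTerm K s I
      = ∑ I ∈ F.attach.map ⟨fun I => (⟨I.1, hF I.1 I.2⟩ : idealsSupportedOn K T),
          fun I J h => Subtype.ext (Subtype.ext (Subtype.mk.inj h))⟩, zetaTerm K s I := by
        rw [Finset.sum_map, ← Finset.sum_attach]; rfl
    _ ≤ _ := ENNReal.sum_le_tsum _

/-- Near `1` the real zeta function is finite: otherwise the Dirichlet series would diverge and
take the value `0`, contradicting the class number formula. -/
theorem eventually_dedekindZeta_eq (K : Type*) [Field K] [NumberField K] :
    ∀ᶠ s : ℝ in 𝓝[>] 1, eZeta K s ≠ ⊤ ∧ dedekindZeta K s = (eZeta K s).toReal := by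
  have hne : ∀ᶠ s : ℝ in 𝓝[>] 1, ((s : ℂ) - 1) * dedekindZeta K s ≠ 0 :=
    (tendsto_sub_one_mul_dedekindZeta_nhdsGT K).eventually_ne
      (by exact_mod_cast dedekindZeta_residue_ne_zero K)
  filter_upwards [hne, self_mem_nhdsWithin] with s hs (hs1 : 1 < s)
  have hsum : LSeriesSummable
      (fun n => (Nat.card {I : Ideal (𝓞 K) // Ideal.absNorm I = n} : ℂ)) s := by
    by_contra h
    refine hs ?_
    rw [dedekindZeta, LSeries, tsum_eq_zero_of_not_summable h, mul_zero]
  -- the terms of the Dirichlet series, as real numbers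
  set c : ℕ → ℝ := fun n => if n = 0 then 0 else
    Nat.card {I : Ideal (𝓞 K) // Ideal.absNorm I = n} * (n : ℝ) ^ (-s) with hc
  have hc0 : ∀ n, 0 ≤ c n := fun n => by simp only [hc]; split_ifs <;> positivity
  have hterm : ∀ n, LSeries.term
      (fun n => (Nat.card {I : Ideal (𝓞 K) // Ideal.absNorm I = n} : ℂ)) s n = (c n : ℂ) := by
    intro n
    rw [LSeries.term_def]
    simp only [hc]
    split_ifs with hn
    · simp
    · rw [Real.rpow_neg (by positivity), Complex.ofReal_mul, Complex.ofReal_inv,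
        Complex.ofReal_cpow (by positivity)]
      simp [div_eq_mul_inv]
  have hcs : Summable c := by
    rw [← Complex.summable_ofReal]
    exact hsum.congr fun n => (hterm n)
  -- grouping the ideals by their norm
  have hez : eZeta K s = ∑' n, ENNReal.ofReal (c n) := by
    rw [eZeta, ← (Equiv.sigmaFiberEquiv
      (fun I : {I : Ideal (𝓞 K) // I ≠ ⊥} => Ideal.absNorm I.1)).tsum_eq, ENNReal.tsum_sigma']
    refine tsum_congr fun n => ?_
    rcases eq_or_ne n 0 with rfl | hn
    · have : IsEmpty {I : {I : Ideal (𝓞 K) // I ≠ ⊥} // Ideal.absNorm I.1 = 0} :=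
        ⟨fun I => I.1.2 (Ideal.absNorm_eq_zero_iff.mp I.2)⟩
      simp [hc]
    · have hfin : Finite {I : Ideal (𝓞 K) // Ideal.absNorm I = n} :=
        Ideal.finite_setOfPred_absNorm_eq n
      have e : {I : {I : Ideal (𝓞 K) // I ≠ ⊥} // Ideal.absNorm I.1 = n} ≃
          {I : Ideal (𝓞 K) // Ideal.absNorm I = n} :=
        Equiv.subtypeSubtypeEquivSubtype (p := fun I : Ideal (𝓞 K) => I ≠ ⊥)
          (q := fun I => Ideal.absNorm I = n)
          fun {I} hI h0 => hn (by rw [← hI, h0, Ideal.absNorm_bot])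
      have hval : ∀ I : {I : {I : Ideal (𝓞 K) // I ≠ ⊥} // Ideal.absNorm I.1 = n},
          zetaTerm K s I.1.1 = (n : ℝ≥0∞) ^ (-s) := fun I => by rw [zetaTerm, I.2]
      refine (tsum_congr hval).trans ?_
      rw [ENNReal.tsum_const, ENat.card_congr e, ENat.card_eq_coe_natCard]
      simp only [hc, if_neg hn]
      rw [ENNReal.ofReal_mul (by positivity), ENNReal.ofReal_natCast,
        ← ENNReal.ofReal_rpow_of_pos (by positivity), ENNReal.ofReal_natCast]
      simp
  rw [hez, ← ENNReal.ofReal_tsum_of_nonneg hc0 hcs]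
  refine ⟨ENNReal.ofReal_ne_top, ?_⟩
  rw [ENNReal.toReal_ofReal (tsum_nonneg hc0), dedekindZeta, LSeries, Complex.ofReal_tsum]
  exact tsum_congr hterm

/-- The class number formula: the zeta function has a simple pole at `1`. -/
theorem tendsto_sub_one_mul_eZeta (K : Type*) [Field K] [NumberField K] :
    Tendsto (fun s : ℝ => (s - 1) * (eZeta K s).toReal) (𝓝[>] 1)
      (𝓝 (dedekindZeta_residue K)) := by
  refine ((Complex.continuous_re.tendsto _).comp
    (tendsto_sub_one_mul_dedekindZeta_nhdsGT K)).congr' ?_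
  filter_upwards [eventually_dedekindZeta_eq K] with s hs
  rw [Function.comp_apply, hs.2]
  norm_cast
end

/-! ### Completely split primes and the pole of the zeta function -/

section
variable (K : Type*) [Field K] [NumberField K]

/-- The completely split rational primes, encoded by counting: `p` lies in this set when there are
`[K : ℚ]` primes above it. -/
def splitPrimes : Set Nat.Primes := {p | primesAboveCard K p = Module.finrank ℚ K}

/-- The Euler factor `(1 - p⁻ˢ)⁻¹`. -/
noncomputable def eulerFactor (s : ℝ) (p : Nat.Primes) : ℝ≥0∞ :=
  (1 - (((p : ℕ) : ℝ≥0∞) ^ (-s)))⁻¹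

open scoped Classical in
/-- The Euler product over the primes in a set `S`, as a supremum of finite products. -/
noncomputable def partialZeta (S : Set Nat.Primes) (s : ℝ) : ℝ≥0∞ :=
  ⨆ U : Finset Nat.Primes, ∏ p ∈ U with p ∈ S, eulerFactor s p

theorem finite_setOf_natCast_mem {p : ℕ} (hp : p ≠ 0) :
    {v : HeightOneSpectrum (𝓞 K) | (p : 𝓞 K) ∈ v.asIdeal}.Finite := by
  have : Ideal.span {(p : 𝓞 K)} ≠ 0 := by simpa
  refine (Ideal.finite_factors this).subset fun v hv => ?_
  simpa [Ideal.dvd_iff_le, Ideal.span_le] using hv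

/-- The places above `p`. -/
noncomputable def placesAbove (p : Nat.Primes) : Finset (HeightOneSpectrum (𝓞 K)) :=
  (finite_setOf_natCast_mem K p.2.ne_zero).toFinset

variable {K}

@[simp]
theorem mem_placesAbove {p : Nat.Primes} {v : HeightOneSpectrum (𝓞 K)} :
    v ∈ placesAbove K p ↔ ((p : ℕ) : 𝓞 K) ∈ v.asIdeal := by
  simp [placesAbove]

theorem card_placesAbove (p : Nat.Primes) :
    (placesAbove K p).card = primesAboveCard K p := by
  refine Finset.card_bij (fun v _ => v.asIdeal)
    (fun v hv => (mem_primesOverFinset_iff_mem p.2).mpr ⟨v.isPrime, mem_placesAbove.mp hv⟩)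
    (fun v _ w _ h => HeightOneSpectrum.ext h) fun Q hQ => ?_
  obtain ⟨hQ, hpQ⟩ := (mem_primesOverFinset_iff_mem p.2).mp hQ
  refine ⟨⟨Q, hQ, ?_⟩, mem_placesAbove.mpr hpQ, rfl⟩
  rintro rfl
  exact p.2.ne_zero (by simpa using hpQ)

theorem primesAboveCard_le_finrank (p : Nat.Primes) :
    primesAboveCard K p ≤ Module.finrank ℚ K := by
  rw [← sum_ramificationIdx_mul_inertiaDeg p.2, primesAboveCard, Finset.card_eq_sum_ones]
  refine Finset.sum_le_sum fun P hP => ?_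
  have := ((mem_primesOverFinset_iff_mem p.2).mp hP).1
  exact Nat.mul_pos (Ideal.ramificationIdx_pos P ℤ) (Ideal.inertiaDeg_pos P ℤ)

theorem splitPrimes_rat : splitPrimes ℚ = Set.univ := by
  refine Set.eq_univ_of_forall fun p => ?_
  have hle := primesAboveCard_le_finrank (K := ℚ) p
  have hsum := sum_ramificationIdx_mul_inertiaDeg (K := ℚ) p.2
  rw [Module.finrank_self] at hle hsum
  rw [splitPrimes, Set.mem_ofPred_eq, Module.finrank_self]
  refine le_antisymm hle (Nat.pos_of_ne_zero fun h => ?_)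
  rw [Finset.card_eq_zero.mp h, Finset.sum_empty] at hsum
  exact absurd hsum (by norm_num)

theorem exists_mem_placesAbove (v : HeightOneSpectrum (𝓞 K)) :
    ∃ p : Nat.Primes, v ∈ placesAbove K p := by
  have := v.isPrime
  have : NeZero v.asIdeal := ⟨v.ne_bot⟩
  refine ⟨⟨Ideal.absNorm (Ideal.under ℤ v.asIdeal), Nat.absNorm_under_prime v.asIdeal⟩,
    mem_placesAbove.mpr ?_⟩
  simpa using Int.absNorm_under_mem v.asIdeal

theorem eq_of_mem_placesAbove {p q : Nat.Primes} {v : HeightOneSpectrum (𝓞 K)}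
    (hp : v ∈ placesAbove K p) (hq : v ∈ placesAbove K q) : p = q := by
  by_contra hne
  have hcop : IsCoprime ((p : ℕ) : ℤ) ((q : ℕ) : ℤ) :=
    Nat.isCoprime_iff_coprime.mpr ((Nat.coprime_primes p.2 q.2).mpr fun h => hne (Subtype.ext h))
  obtain ⟨a, b, hab⟩ := hcop
  refine v.isPrime.ne_top ((Ideal.eq_top_iff_one _).mpr ?_)
  have : (1 : 𝓞 K) = a * (p : ℕ) + b * (q : ℕ) := by exact_mod_cast hab.symm
  rw [this]
  exact add_mem (Ideal.mul_mem_left _ _ (mem_placesAbove.mp hp))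
    (Ideal.mul_mem_left _ _ (mem_placesAbove.mp hq))

theorem zetaTerm_asIdeal (s : ℝ) {p : Nat.Primes} {v : HeightOneSpectrum (𝓞 K)}
    (hv : v ∈ placesAbove K p) :
    zetaTerm K s v.asIdeal = ((p : ℕ) : ℝ≥0∞) ^ (-(v.asIdeal.inertiaDeg ℤ * s)) := by
  have := v.isPrime
  have : v.asIdeal.LiesOver (Ideal.span {((p : ℕ) : ℤ)}) :=
    (Ideal.liesOver_span_iff v.isPrime.ne_top (Nat.prime_iff_prime_int.mp p.2)).mpr
      (by simpa using hv)
  rw [zetaTerm, ← Ideal.pow_inertiaDeg p v.asIdeal, Nat.cast_pow, ← ENNReal.rpow_natCast,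
    ← ENNReal.rpow_mul, mul_neg]

theorem one_le_eulerFactor (s : ℝ) (p : Nat.Primes) : 1 ≤ eulerFactor s p :=
  ENNReal.one_le_inv.mpr tsub_le_self

theorem inv_one_sub_zetaTerm_le {s t : ℝ} {p : Nat.Primes} {v : HeightOneSpectrum (𝓞 K)}
    (hv : v ∈ placesAbove K p) (ht : t ≤ v.asIdeal.inertiaDeg ℤ * s) :
    (1 - zetaTerm K s v.asIdeal)⁻¹ ≤ eulerFactor t p := by
  rw [zetaTerm_asIdeal s hv, eulerFactor]
  refine ENNReal.inv_le_inv.mpr (tsub_le_tsub_left ?_ _)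
  exact ENNReal.rpow_le_rpow_of_exponent_le (by exact_mod_cast p.2.one_lt.le) (neg_le_neg ht)

theorem eulerFactor_antitone {s t : ℝ} (h : s ≤ t) (p : Nat.Primes) :
    eulerFactor t p ≤ eulerFactor s p :=
  ENNReal.inv_le_inv.mpr (tsub_le_tsub_left (ENNReal.rpow_le_rpow_of_exponent_le
    (by exact_mod_cast p.2.one_lt.le) (neg_le_neg h)) _)

theorem eulerFactor_ne_top {s : ℝ} (hs : 0 < s) (p : Nat.Primes) : eulerFactor s p ≠ ⊤ := by
  rw [eulerFactor, ENNReal.inv_ne_top, ne_eq, tsub_eq_zero_iff_le, not_le, ENNReal.rpow_neg,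
    ENNReal.inv_lt_one]
  exact ENNReal.one_lt_rpow (by exact_mod_cast p.2.one_lt) hs

/-- The local factor of the zeta function at `p` is bounded by the power of a single Euler factor
determined by a lower bound for the residue degrees. -/
theorem prod_placesAbove_le {s t : ℝ} {p : Nat.Primes}
    (h : ∀ v ∈ placesAbove K p, t ≤ v.asIdeal.inertiaDeg ℤ * s) :
    ∏ v ∈ placesAbove K p, (1 - zetaTerm K s v.asIdeal)⁻¹ ≤
      eulerFactor t p ^ Module.finrank ℚ K :=
  (Finset.prod_le_pow_card _ _ _ fun v hv => inv_one_sub_zetaTerm_le hv (h v hv)).trans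
    (pow_le_pow_right₀ (one_le_eulerFactor t p)
      ((card_placesAbove p).trans_le (primesAboveCard_le_finrank p)))

theorem prod_placesAbove_eq {s : ℝ} {p : Nat.Primes} (hp : p ∈ splitPrimes K) :
    ∏ v ∈ placesAbove K p, (1 - zetaTerm K s v.asIdeal)⁻¹ =
      eulerFactor s p ^ Module.finrank ℚ K := by
  rw [← show _ = Module.finrank ℚ K from hp, ← card_placesAbove, ← Finset.prod_const]
  refine Finset.prod_congr rfl fun v hv => ?_
  have := v.isPrime
  have hv' := mem_placesAbove.mp hv
  have h1 : v.asIdeal.inertiaDeg ℤ = 1 := (inertiaDeg_eq_one_iff_forall_pow_sub_mem p.2 hv').mpr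
    (residueFieldsTrivial_of_primesAboveCard_eq p.2 hp _ v.isPrime hv')
  rw [zetaTerm_asIdeal s hv, h1, Nat.cast_one, one_mul, eulerFactor]

theorem prod_le_partialZeta {S : Set Nat.Primes} {U : Finset Nat.Primes} (hU : ∀ p ∈ U, p ∈ S)
    (s : ℝ) : ∏ p ∈ U, eulerFactor s p ≤ partialZeta S s := by
  classical
  refine le_trans (le_of_eq ?_) (le_iSup _ U)
  rw [Finset.filter_true_of_mem hU]

theorem prod_biUnion_placesAbove [DecidableEq (HeightOneSpectrum (𝓞 K))] (U : Finset Nat.Primes)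
    (f : HeightOneSpectrum (𝓞 K) → ℝ≥0∞) :
    ∏ v ∈ U.biUnion (placesAbove K), f v = ∏ p ∈ U, ∏ v ∈ placesAbove K p, f v :=
  Finset.prod_biUnion fun _ _ _ _ hne =>
    Finset.disjoint_left.mpr fun _ hp hq => hne (eq_of_mem_placesAbove hp hq)

/-- The completely split primes alone contribute the `[K : ℚ]`-th power of their Euler product. -/
theorem partialZeta_splitPrimes_pow_le (s : ℝ) :
    partialZeta (splitPrimes K) s ^ Module.finrank ℚ K ≤ eZeta K s := by
  classical
  rw [partialZeta, ENNReal.iSup_pow]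
  refine iSup_le fun U => ?_
  refine le_trans (le_of_eq ?_) (prod_le_eZeta (K := K) s
    ((U.filter (· ∈ splitPrimes K)).biUnion (placesAbove K)))
  rw [prod_biUnion_placesAbove, ← Finset.prod_pow]
  exact Finset.prod_congr rfl fun p hp => (prod_placesAbove_eq (Finset.mem_filter.mp hp).2).symm

/-- The Euler product of the Riemann zeta function converges at `2`, because it does at points
arbitrarily close to `1`. -/
theorem exists_prod_eulerFactor_two_le :
    ∃ C : ℝ≥0∞, C ≠ ⊤ ∧ ∀ U : Finset Nat.Primes, ∏ p ∈ U, eulerFactor 2 p ≤ C := by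
  obtain ⟨s, hs, hs2⟩ := ((eventually_dedekindZeta_eq ℚ).and
    (Ioo_mem_nhdsGT (show (1 : ℝ) < 2 by norm_num))).exists
  refine ⟨eZeta ℚ s, hs.1, fun U => ?_⟩
  refine (Finset.prod_le_prod' fun p _ => eulerFactor_antitone hs2.2.le p).trans ?_
  refine le_trans ?_ (partialZeta_splitPrimes_pow_le (K := ℚ) s)
  rw [Module.finrank_self, pow_one, splitPrimes_rat]
  exact prod_le_partialZeta (fun _ _ => Set.mem_univ _) s

/-- Finitely many primes change an Euler product by at most a factor that is bounded for `1 ≤ s`. -/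
theorem exists_partialZeta_le_mul {S S' : Set Nat.Primes} (h : (S \ S').Finite) :
    ∃ C : ℝ≥0∞, C ≠ ⊤ ∧ ∀ s : ℝ, 1 ≤ s → partialZeta S s ≤ C * partialZeta S' s := by
  classical
  refine ⟨∏ p ∈ h.toFinset, eulerFactor 1 p,
    ENNReal.prod_ne_top fun p _ => eulerFactor_ne_top one_pos p, fun s hs => ?_⟩
  refine iSup_le fun U => ?_
  rw [← Finset.prod_filter_not_mul_prod_filter (U.filter (· ∈ S)) (· ∈ S')]
  refine mul_le_mul' ?_ (prod_le_partialZeta (fun p hp => (Finset.mem_filter.mp hp).2) s)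
  refine (Finset.prod_le_prod' fun p _ => eulerFactor_antitone hs p).trans
    (Finset.prod_le_prod_of_subset_of_one_le' (fun p hp => ?_) fun p _ _ => one_le_eulerFactor 1 p)
  simp only [Finset.mem_filter] at hp
  simpa using ⟨hp.1.2, hp.2⟩

theorem partialZeta_empty (s : ℝ) : partialZeta ∅ s = 1 := by
  simp [partialZeta]

/-- In a Galois extension the residue degrees above an unramified prime that does not split
completely are all at least two, so that these primes contribute a bounded factor. -/
theorem exists_eZeta_le_mul_partialZeta_pow [IsGalois ℚ K] :
    ∃ C : ℝ≥0∞, C ≠ ⊤ ∧ ∀ s : ℝ, 1 ≤ s →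
      eZeta K s ≤ C * partialZeta (splitPrimes K) s ^ Module.finrank ℚ K := by
  classical
  set n := Module.finrank ℚ K
  obtain ⟨B, hB, hBU⟩ := exists_prod_eulerFactor_two_le
  -- `B` bounds the contribution of the primes of residue degree at least two, `D` that of the
  -- ramified primes
  let R : Set Nat.Primes := {p | ((p : ℕ) : ℤ) ∣ discr K}
  have hR : R.Finite := (finite_setOf_dvd (discr_ne_zero K)).preimage
    (f := ((↑) : Nat.Primes → ℕ)) Subtype.val_injective.injOn
  obtain ⟨D, hD, hDR⟩ := exists_partialZeta_le_mul (S := R) (S' := ∅) (by simpa using hR)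
  refine ⟨(B * D) ^ n, ENNReal.pow_ne_top (ENNReal.mul_ne_top hB hD), fun s hs => ?_⟩
  have hpos : ∀ v : HeightOneSpectrum (𝓞 K), (1 : ℝ) ≤ v.asIdeal.inertiaDeg ℤ := fun v => by
    have := v.isPrime
    exact_mod_cast Ideal.inertiaDeg_pos v.asIdeal ℤ
  have hlocal : ∀ p : Nat.Primes,
      ∏ v ∈ placesAbove K p, (1 - zetaTerm K s v.asIdeal)⁻¹ ≤
        (eulerFactor 2 p * (if p ∈ R then eulerFactor 1 p else 1) *
          (if p ∈ splitPrimes K then eulerFactor s p else 1)) ^ n := by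
    intro p
    by_cases hS : p ∈ splitPrimes K
    · rw [prod_placesAbove_eq hS, if_pos hS]
      refine pow_le_pow_left' (le_mul_of_one_le_left' (one_le_mul (one_le_eulerFactor 2 p) ?_)) n
      split_ifs
      exacts [one_le_eulerFactor 1 p, le_rfl]
    rw [if_neg hS, mul_one]
    by_cases hpR : p ∈ R
    · rw [if_pos hpR]
      refine (prod_placesAbove_le (t := 1) fun v _ => ?_).trans
        (pow_le_pow_left' (le_mul_of_one_le_left' (one_le_eulerFactor 2 p)) n)
      nlinarith [hpos v]
    · rw [if_neg hpR, mul_one]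
      refine prod_placesAbove_le fun v hv => ?_
      obtain ⟨Q, hQ, hpQ, hQ1⟩ : ∃ Q : Ideal (𝓞 K), Q.IsPrime ∧ ((p : ℕ) : 𝓞 K) ∈ Q ∧
          Q.inertiaDeg ℤ ≠ 1 := by
        by_contra! h
        exact hS (primesAboveCard_eq_of_forall_inertiaDeg_eq_one p.2 hpR h)
      have hp' := Nat.prime_iff_prime_int.mp p.2
      have := v.isPrime
      have : v.asIdeal.LiesOver (Ideal.span {((p : ℕ) : ℤ)}) :=
        (Ideal.liesOver_span_iff v.isPrime.ne_top hp').mpr (by simpa using hv)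
      have : Q.LiesOver (Ideal.span {((p : ℕ) : ℤ)}) :=
        (Ideal.liesOver_span_iff hQ.ne_top hp').mpr (by simpa using hpQ)
      -- the Galois group permutes the primes above `p` transitively
      have heq : v.asIdeal.inertiaDeg ℤ = Q.inertiaDeg ℤ :=
        Ideal.inertiaDeg_eq_of_isGaloisGroup (Ideal.span {((p : ℕ) : ℤ)}) v.asIdeal Q (K ≃ₐ[ℚ] K)
      have h2 : 2 ≤ v.asIdeal.inertiaDeg ℤ := by
        have := Ideal.inertiaDeg_pos Q ℤ
        omega
      have h2' : (2 : ℝ) ≤ v.asIdeal.inertiaDeg ℤ := by exact_mod_cast h2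
      nlinarith
  refine eZeta_le s fun T => ?_
  choose π hπ using exists_mem_placesAbove (K := K)
  set U := T.image π
  calc ∏ v ∈ T, (1 - zetaTerm K s v.asIdeal)⁻¹
      ≤ ∏ v ∈ U.biUnion (placesAbove K), (1 - zetaTerm K s v.asIdeal)⁻¹ :=
        Finset.prod_le_prod_of_subset_of_one_le'
          (fun v hv => Finset.mem_biUnion.mpr ⟨π v, Finset.mem_image_of_mem _ hv, hπ v⟩)
          fun v _ _ => ENNReal.one_le_inv.mpr tsub_le_self
    _ ≤ ∏ p ∈ U, (eulerFactor 2 p * (if p ∈ R then eulerFactor 1 p else 1) *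
          (if p ∈ splitPrimes K then eulerFactor s p else 1)) ^ n := by
        rw [prod_biUnion_placesAbove]
        exact Finset.prod_le_prod' fun p _ => hlocal p
    _ ≤ (B * D * partialZeta (splitPrimes K) s) ^ n := by
        rw [Finset.prod_pow, Finset.prod_mul_distrib, Finset.prod_mul_distrib,
          ← Finset.prod_filter, ← Finset.prod_filter]
        refine pow_le_pow_left' (mul_le_mul' (mul_le_mul' (hBU U) ?_) ?_) n
        · refine (prod_le_partialZeta (fun p hp => (Finset.mem_filter.mp hp).2) 1).trans ?_
          simpa [partialZeta_empty] using hDR 1 le_rfl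
        · exact prod_le_partialZeta (fun p hp => (Finset.mem_filter.mp hp).2) s
    _ = _ := mul_pow _ _ _

/-- A Galois number field has infinitely many completely split primes, because its zeta function
is unbounded near `1`. -/
theorem infinite_splitPrimes [IsGalois ℚ K] : (splitPrimes K).Infinite := by
  intro hfin
  obtain ⟨C, hC, hCle⟩ := exists_eZeta_le_mul_partialZeta_pow (K := K)
  obtain ⟨D, hD, hDle⟩ :=
    exists_partialZeta_le_mul (S := splitPrimes K) (S' := ∅) (by simpa using hfin)
  set b := (C * D ^ Module.finrank ℚ K).toReal
  have hb : C * D ^ Module.finrank ℚ K ≠ ⊤ := ENNReal.mul_ne_top hC (ENNReal.pow_ne_top hD)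
  have hlim : Tendsto (fun s : ℝ => (s - 1) * b) (𝓝[>] 1) (𝓝 0) := by
    refine tendsto_nhdsWithin_of_tendsto_nhds ?_
    have : Continuous fun s : ℝ => (s - 1) * b := by fun_prop
    simpa using this.tendsto 1
  refine absurd (le_of_tendsto_of_tendsto (tendsto_sub_one_mul_eZeta K) hlim ?_)
    (not_le.mpr (dedekindZeta_residue_pos K))
  filter_upwards [self_mem_nhdsWithin] with s (hs : 1 < s)
  refine mul_le_mul_of_nonneg_left (ENNReal.toReal_mono hb ((hCle s hs.le).trans ?_)) (by linarith)
  gcongr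
  simpa [partialZeta_empty] using hDle s hs.le

/-- Comparing the order of the poles at `1`: if almost all completely split primes of a Galois
field `K` split completely in `M`, then the degree of `M` is at most that of `K`. -/
theorem finrank_le_of_finite_splitPrimes_diff [IsGalois ℚ K] {M : Type*} [Field M] [NumberField M]
    (h : (splitPrimes K \ splitPrimes M).Finite) : Module.finrank ℚ M ≤ Module.finrank ℚ K := by
  by_contra! hlt
  set n := Module.finrank ℚ K
  set m := Module.finrank ℚ M
  obtain ⟨C, hC, hCle⟩ := exists_eZeta_le_mul_partialZeta_pow (K := K)
  obtain ⟨D, hD, hDle⟩ := exists_partialZeta_le_mul h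
  set b := C ^ m * (D ^ n) ^ m
  have hb : b ≠ ⊤ := ENNReal.mul_ne_top (ENNReal.pow_ne_top hC)
    (ENNReal.pow_ne_top (ENNReal.pow_ne_top hD))
  -- the left side has a pole of order `m` at `1`, the right side one of order `n < m`
  have hle : ∀ s : ℝ, 1 ≤ s → eZeta K s ^ m ≤ b * eZeta M s ^ n := fun s hs => calc
    eZeta K s ^ m ≤ (C * (D * partialZeta (splitPrimes M) s) ^ n) ^ m := by
        refine pow_le_pow_left' ((hCle s hs).trans ?_) m
        gcongr
        exact hDle s hs
    _ = b * (partialZeta (splitPrimes M) s ^ m) ^ n := by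
        simp only [b, mul_pow, ← pow_mul, mul_comm n m, mul_assoc]
    _ ≤ b * eZeta M s ^ n := by
        gcongr
        exact partialZeta_splitPrimes_pow_le s
  have hlim : Tendsto
      (fun s : ℝ => b.toReal * (s - 1) ^ (m - n) * ((s - 1) * (eZeta M s).toReal) ^ n)
      (𝓝[>] 1) (𝓝 0) := by
    have h1 : Tendsto (fun s : ℝ => b.toReal * (s - 1) ^ (m - n)) (𝓝[>] 1) (𝓝 0) := by
      refine tendsto_nhdsWithin_of_tendsto_nhds ?_
      have : Continuous fun s : ℝ => b.toReal * (s - 1) ^ (m - n) := by fun_prop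
      simpa [Nat.sub_ne_zero_of_lt hlt] using this.tendsto 1
    simpa using h1.mul ((tendsto_sub_one_mul_eZeta M).pow n)
  refine absurd (le_of_tendsto_of_tendsto ((tendsto_sub_one_mul_eZeta K).pow m) hlim ?_)
    (not_le.mpr (pow_pos (dedekindZeta_residue_pos K) m))
  filter_upwards [self_mem_nhdsWithin, eventually_dedekindZeta_eq M] with s (hs : 1 < s) hM
  have hreal := ENNReal.toReal_mono (ENNReal.mul_ne_top hb (ENNReal.pow_ne_top hM.1)) (hle s hs.le)
  rw [ENNReal.toReal_mul, ENNReal.toReal_pow, ENNReal.toReal_pow] at hreal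
  calc ((s - 1) * (eZeta K s).toReal) ^ m
      = (s - 1) ^ m * (eZeta K s).toReal ^ m := mul_pow _ _ _
    _ ≤ (s - 1) ^ m * (b.toReal * (eZeta M s).toReal ^ n) :=
        mul_le_mul_of_nonneg_left hreal (pow_nonneg (by linarith) m)
    _ = _ := by
        rw [mul_pow, ← Nat.sub_add_cancel hlt.le, pow_add, Nat.add_sub_cancel]
        ring
end

/-! ### Number fields with equally many primes above almost all rational primes -/

section
variable {K L M : Type*} [Field K] [NumberField K] [Field L] [NumberField L]
  [Field M] [NumberField M]

theorem finite_setOf_primes {P : ℕ → Prop} (h : {p : ℕ | p.Prime ∧ P p}.Finite) :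
    {p : Nat.Primes | P p}.Finite :=
  (h.preimage (f := ((↑) : Nat.Primes → ℕ)) Subtype.val_injective.injOn).subset
    fun p hp => ⟨p.2, hp⟩

theorem splitPrimes_subset : splitPrimes K ⊆ {p | ResidueFieldsTrivial K p} := fun p hp =>
  residueFieldsTrivial_of_primesAboveCard_eq p.2 hp

theorem finite_residueFieldsTrivial_diff_splitPrimes (K : Type*) [Field K] [NumberField K] :
    ({p : Nat.Primes | ResidueFieldsTrivial K p} \ splitPrimes K).Finite :=
  finite_setOf_primes (finite_residueFieldsTrivial_and_primesAboveCard_ne K)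

/-- A field containing `K` has no completely split primes beyond those of `K`, up to finitely
many exceptions. -/
theorem finite_splitPrimes_diff_of_ringHom (f : K →+* M) :
    (splitPrimes M \ splitPrimes K).Finite :=
  (finite_residueFieldsTrivial_diff_splitPrimes K).subset fun _ hp =>
    ⟨(splitPrimes_subset hp.1).of_ringHom f, hp.2⟩

/-- Almost all primes that split completely in two fields split completely in the compositum. -/
theorem finite_splitPrimes_inter_diff (f : K →+* M) (g : L →+* M)
    (hfg : f.fieldRange ⊔ g.fieldRange = ⊤) :
    ((splitPrimes K ∩ splitPrimes L) \ splitPrimes M).Finite := by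
  refine ((finite_residueFieldsTrivial_diff_splitPrimes M).union
    (finite_setOf_primes (finite_residueFieldsTrivial_of_sup_eq_top f g hfg))).subset ?_
  intro p hp
  by_cases h : ResidueFieldsTrivial M p
  · exact Or.inl ⟨h, hp.2⟩
  · exact Or.inr ⟨splitPrimes_subset hp.1.1, splitPrimes_subset hp.1.2, h⟩

/-- Almost all primes have equally many primes above them in `K` and in `L`. -/
def PrimesAboveCardEquivalent (K L : Type*) [Field K] [NumberField K] [Field L] [NumberField L] :
    Prop :=
  {p : Nat.Primes | primesAboveCard K p ≠ primesAboveCard L p}.Finite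

/-- Almost all of the infinitely many primes that split completely in a common Galois extension
have `[K : ℚ]` primes above them in `K` and `[L : ℚ]` in `L`. -/
theorem PrimesAboveCardEquivalent.finrank_eq [IsGalois ℚ M] (f : K →+* M) (g : L →+* M)
    (h : PrimesAboveCardEquivalent K L) : Module.finrank ℚ K = Module.finrank ℚ L := by
  obtain ⟨p, hpM, hp⟩ := ((infinite_splitPrimes (K := M)).sdiff
    (((finite_splitPrimes_diff_of_ringHom f).union
      (finite_splitPrimes_diff_of_ringHom g)).union h)).nonempty
  simp only [Set.mem_union, Set.mem_sdiff, hpM, true_and, not_or, not_not, Set.mem_ofPred_eq] at hp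
  obtain ⟨⟨hK, hL⟩, heq⟩ := hp
  rw [splitPrimes, Set.mem_ofPred_eq] at hK hL
  rw [← hK, heq, hL]

theorem PrimesAboveCardEquivalent.finite_splitPrimes_diff (h : PrimesAboveCardEquivalent K L)
    (hn : Module.finrank ℚ K = Module.finrank ℚ L) : (splitPrimes K \ splitPrimes L).Finite := by
  refine Set.Finite.subset h fun p hp heq => hp.2 ?_
  rw [splitPrimes, Set.mem_ofPred_eq, ← heq, ← hn]
  exact hp.1

theorem fieldRange_inclusion_sup_fieldRange_inclusion {Ω : Type*} [Field Ω] [CharZero Ω]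
    (E F : IntermediateField ℚ Ω) :
    (IntermediateField.inclusion (le_sup_left : E ≤ E ⊔ F)).toRingHom.fieldRange ⊔
      (IntermediateField.inclusion (le_sup_right : F ≤ E ⊔ F)).toRingHom.fieldRange = ⊤ := by
  set S := (IntermediateField.inclusion (le_sup_left : E ≤ E ⊔ F)).toRingHom.fieldRange ⊔
    (IntermediateField.inclusion (le_sup_right : F ≤ E ⊔ F)).toRingHom.fieldRange
  let S' : IntermediateField ℚ Ω := (S.map (E ⊔ F).val.toRingHom).toIntermediateField
    fun q => by rw [eq_ratCast]; exact SubfieldClass.ratCast_mem _ q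
  have h : E ⊔ F ≤ S' := by
    refine sup_le (fun x hx => ?_) fun x hx => ?_
    · exact ⟨_, (le_sup_left : _ ≤ S) ⟨⟨x, hx⟩, rfl⟩, rfl⟩
    · exact ⟨_, (le_sup_right : _ ≤ S) ⟨⟨x, hx⟩, rfl⟩, rfl⟩
  refine eq_top_iff.mpr fun x _ => ?_
  obtain ⟨y, hy, hyx⟩ := h x.2
  rwa [← Subtype.ext (show (y : Ω) = x from hyx)]
end

section
variable {K L Ω : Type*} [Field K] [NumberField K] [Field L] [NumberField L]
  [Field Ω] [CharZero Ω] [IsAlgClosed Ω] [Algebra.IsAlgebraic ℚ Ω]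

/-- `L` embeds into the normal closure of `K` as soon as almost all primes have equally many
primes above them in both fields. -/
theorem PrimesAboveCardEquivalent.fieldRange_le_normalClosure
    (h : PrimesAboveCardEquivalent K L) (g : L →ₐ[ℚ] Ω) :
    g.fieldRange ≤ IntermediateField.normalClosure ℚ K Ω := by
  have : IsAlgClosure ℚ Ω := ⟨inferInstance, inferInstance⟩
  have : Normal ℚ Ω := IsAlgClosure.normal ℚ Ω
  set N := IntermediateField.normalClosure ℚ K Ω
  have f : K →ₐ[ℚ] Ω := IsAlgClosed.lift
  have hf : f.fieldRange ≤ N := f.fieldRange_le_normalClosure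
  have : FiniteDimensional ℚ g.fieldRange := g.toLinearMap.finiteDimensional_range
  have : FiniteDimensional ℚ N := normalClosure.is_finiteDimensional ℚ K _
  have : Normal ℚ N := normalClosure.normal ℚ K _
  -- a common Galois extension of `K` and `L`, used for the equality of their degrees
  set N' := IntermediateField.normalClosure ℚ ↥(N ⊔ g.fieldRange) Ω
  have : FiniteDimensional ℚ N' := normalClosure.is_finiteDimensional ℚ _ _
  have : Normal ℚ N' := normalClosure.normal ℚ _ _
  have : NumberField N := NumberField.of_module_finite ℚ N
  have : NumberField N' := NumberField.of_module_finite ℚ N'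
  have : NumberField ↥(N ⊔ g.fieldRange) := NumberField.of_module_finite ℚ _
  have : IsGalois ℚ N := ⟨⟩
  have : IsGalois ℚ N' := ⟨⟩
  have hN' : N ⊔ g.fieldRange ≤ N' := by
    have := (N ⊔ g.fieldRange).val.fieldRange_le_normalClosure
    rwa [IntermediateField.fieldRange_val] at this
  -- the embeddings of `K` and of `L` into the various composita
  let fN : K →+* N := ((IntermediateField.inclusion hf).comp f.rangeRestrict).toRingHom
  let gF : L →+* g.fieldRange := g.rangeRestrict.toRingHom
  let iN := (IntermediateField.inclusion (le_sup_left : N ≤ N ⊔ g.fieldRange)).toRingHom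
  let iF := (IntermediateField.inclusion (le_sup_right : _ ≤ N ⊔ g.fieldRange)).toRingHom
  let j := (IntermediateField.inclusion hN').toRingHom
  have hsup : iN.fieldRange ⊔ (iF.comp gF).fieldRange = ⊤ := by
    rw [eq_top_iff, ← fieldRange_inclusion_sup_fieldRange_inclusion N g.fieldRange]
    refine sup_le_sup le_rfl ?_
    rintro _ ⟨⟨_, y, rfl⟩, rfl⟩
    exact ⟨y, rfl⟩
  have hn : Module.finrank ℚ K = Module.finrank ℚ L :=
    h.finrank_eq (j.comp (iN.comp fN)) (j.comp (iF.comp gF))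
  -- a prime that splits completely in `N` does so in `K`, hence in `L`, hence in the compositum
  have hsplit : (splitPrimes N \ splitPrimes ↥(N ⊔ g.fieldRange)).Finite := by
    refine (((finite_splitPrimes_diff_of_ringHom fN).union
      (h.finite_splitPrimes_diff hn)).union
        (finite_splitPrimes_inter_diff iN (iF.comp gF) hsup)).subset ?_
    rintro p ⟨hpN, hpM⟩
    by_cases hK : p ∈ splitPrimes K
    · by_cases hL : p ∈ splitPrimes L
      · exact Or.inr ⟨⟨hpN, hL⟩, hpM⟩
      · exact Or.inl (Or.inr ⟨hK, hL⟩)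
    · exact Or.inl (Or.inl ⟨hpN, hK⟩)
  rw [IntermediateField.eq_of_le_of_finrank_le (le_sup_left (b := g.fieldRange))
    (finrank_le_of_finite_splitPrimes_diff hsplit)]
  exact le_sup_right

theorem finite_setOf_intermediateField_le {k E : Type*} [Field k] [Field E] [Algebra k E]
    (N : IntermediateField k E) [FiniteDimensional k N] [Algebra.IsSeparable k N] :
    {F : IntermediateField k E | F ≤ N}.Finite := by
  have : Finite (IntermediateField k N) :=
    (Field.exists_primitive_element_iff_finite_intermediateField k N).mp
      ⟨inferInstance, Field.exists_primitive_element k N⟩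
  refine (Set.finite_range (IntermediateField.lift (F := N))).subset fun F hF => ?_
  exact ⟨IntermediateField.restrict hF, IntermediateField.lift_restrict hF⟩

theorem finite_setOf_le_normalClosure (K Ω : Type*) [Field K] [NumberField K] [Field Ω]
    [CharZero Ω] :
    {F : IntermediateField ℚ Ω | F ≤ IntermediateField.normalClosure ℚ K Ω}.Finite := by
  have := normalClosure.is_finiteDimensional ℚ K Ω
  exact finite_setOf_intermediateField_le _

theorem PrimesAboveCardEquivalent.exists_ringEquiv (h : PrimesAboveCardEquivalent K L) :
    ∃ F ∈ {F : IntermediateField ℚ Ω | F ≤ IntermediateField.normalClosure ℚ K Ω},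
      Nonempty (L ≃+* F) := by
  have g : L →ₐ[ℚ] Ω := IsAlgClosed.lift
  exact ⟨g.fieldRange, h.fieldRange_le_normalClosure g,
    ⟨(AlgEquiv.ofInjectiveField g).toRingEquiv⟩⟩

theorem ArithmeticallyEquivalent.primesAboveCardEquivalent (h : ArithmeticallyEquivalent K L) :
    PrimesAboveCardEquivalent K L := by
  refine Set.Finite.subset (finite_setOf_primes h) fun p hp heq => hp ?_
  have := congrArg Multiset.card heq
  rw [splittingType, splittingType, Multiset.card_map, Multiset.card_map] at this
  exact this

/-- The two ways of viewing the algebraic closure of `ℚ` as an algebra over `ℚ` agree. -/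
theorem isAlgebraic_rat_algebraicClosure : Algebra.IsAlgebraic ℚ (AlgebraicClosure ℚ) := by
  convert AlgebraicClosure.isAlgebraic ℚ
  · rfl
  · exact Subsingleton.elim _ _
end

/-! ### First-order formulas in the language of rings -/

section
open FirstOrder FirstOrder.Language FirstOrder.Ring

variable {A : Type*} [CommRing A]

/-- The condition that `1 + t x²` is a square on the component cut out by the idempotent `e`. -/
def OneAddIsSquareAt (e t x : A) : Prop := ∃ z, e * (1 + t * (x * x)) = e * (z * z)

/-- A first-order property of an idempotent `e` that, at a local component, expresses that the
residue characteristic is `p`: for some `t`, the set of all `x` with `1 + t x²` a square is closed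
under addition and contains `1` but not the inverse of `p`. For `t` a uniformizer this set is the
valuation ring. -/
def DetectsPrime (p : ℕ) (e : A) : Prop :=
  ∃ t, (∀ x y, OneAddIsSquareAt e t x → OneAddIsSquareAt e t y → OneAddIsSquareAt e t (x + y)) ∧
    OneAddIsSquareAt e t 1 ∧ ∀ x, e * (p * x) = e → ¬ OneAddIsSquareAt e t x

/-- Minimal nonzero idempotents. -/
def IsMinimalIdempotent (e : A) : Prop :=
  e * e = e ∧ e ≠ 0 ∧ ∀ f, f * f = f → e * f = 0 ∨ e * f = e

/-- The term `1 + ⋯ + 1` in the language of rings. -/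
def natTerm {α : Type*} : ℕ → Language.ring.Term α
  | 0 => 0
  | n + 1 => natTerm n + 1

/-- The first-order formula for `OneAddIsSquareAt`, with a free variable for the idempotent. -/
def squareFormula {n : ℕ} (t x : Fin n) : Language.ring.BoundedFormula Unit n :=
  ∃' (Term.bdEqual
    (Term.var (Sum.inl ()) * (1 + Term.var (Sum.inr t.castSucc) *
      (Term.var (Sum.inr x.castSucc) * Term.var (Sum.inr x.castSucc))))
    (Term.var (Sum.inl ()) *
      (Term.var (Sum.inr (Fin.last n)) * Term.var (Sum.inr (Fin.last n)))))

/-- The first-order formula for `DetectsPrime p`. -/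
def detectsPrimeFormula (p : ℕ) : Language.ring.Formula Unit :=
  ∃' ((∀' ∀' (squareFormula (n := 3) 0 1 ⟹ (squareFormula (n := 3) 0 2 ⟹
        ∃' (Term.bdEqual (Term.var (Sum.inr 3)) (Term.var (Sum.inr 1) + Term.var (Sum.inr 2)) ⊓
          squareFormula (n := 4) 0 3)))) ⊓
      (∃' (Term.bdEqual (Term.var (Sum.inr 1)) 1 ⊓ squareFormula (n := 2) 0 1)) ⊓
      (∀' (Term.bdEqual (Term.var (Sum.inl ()) * (natTerm p * Term.var (Sum.inr 1)))
          (Term.var (Sum.inl ())) ⟹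
        ∼ (squareFormula (n := 2) 0 1))))

/-- The first-order formula for `IsMinimalIdempotent`. -/
def minimalIdempotentFormula : Language.ring.Formula Unit :=
  Term.bdEqual (Term.var (Sum.inl ()) * Term.var (Sum.inl ())) (Term.var (Sum.inl ())) ⊓
    ∼ (Term.bdEqual (Term.var (Sum.inl ())) 0) ⊓
    ∀' (Term.bdEqual (Term.var (Sum.inr 0) * Term.var (Sum.inr 0)) (Term.var (Sum.inr 0)) ⟹
      (Term.bdEqual (Term.var (Sum.inl ()) * Term.var (Sum.inr 0)) 0 ⊔
        Term.bdEqual (Term.var (Sum.inl ()) * Term.var (Sum.inr 0)) (Term.var (Sum.inl ()))))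

section Realize
variable [CompatibleRing A]

theorem realize_natTerm {α : Type*} (v : α → A) (n : ℕ) :
    (natTerm n).realize v = (n : A) := by
  induction n with
  | zero => simp [natTerm]
  | succ n ih => simp [natTerm, ih]

theorem realize_squareFormula {n : ℕ} (t x : Fin n) (v : Unit → A) (w : Fin n → A) :
    (squareFormula t x).Realize v w ↔ OneAddIsSquareAt (v ()) (w t) (w x) := by
  simp [squareFormula, OneAddIsSquareAt]

theorem realize_detectsPrimeFormula (p : ℕ) (v : Unit → A) :
    (detectsPrimeFormula p).Realize v ↔ DetectsPrime p (v ()) := by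
  simp only [detectsPrimeFormula, DetectsPrime, Formula.Realize, BoundedFormula.realize_ex,
    BoundedFormula.realize_inf, BoundedFormula.realize_all, BoundedFormula.realize_imp,
    BoundedFormula.realize_not, BoundedFormula.realize_bdEqual, realize_squareFormula,
    realize_natTerm, realize_add, realize_mul, realize_one, Term.realize_var, Sum.elim_inl,
    Sum.elim_inr]
  simp [Fin.snoc, and_assoc]

theorem realize_minimalIdempotentFormula (v : Unit → A) :
    minimalIdempotentFormula.Realize v ↔ IsMinimalIdempotent (v ()) := by
  simp only [minimalIdempotentFormula, IsMinimalIdempotent, Formula.Realize,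
    BoundedFormula.realize_inf, BoundedFormula.realize_all, BoundedFormula.realize_imp,
    BoundedFormula.realize_not, BoundedFormula.realize_bdEqual, BoundedFormula.realize_sup,
    realize_zero, realize_mul, Term.realize_var, Sum.elim_inl, Sum.elim_inr]
  simp [Fin.snoc, and_assoc]

end Realize

/-- The sentence asserting that at least `m` elements satisfy the formula `φ`. -/
noncomputable def atLeastSentence (φ : Language.ring.Formula Unit) (m : ℕ) :
    Language.ring.Sentence :=
  Formula.iExs (Fin m)
    (Formula.iInf (fun i : Fin m =>
        Formula.relabel (fun _ => (Sum.inr i : Empty ⊕ Fin m)) φ) ⊓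
      Formula.iInf (fun i : {i : Fin m × Fin m // i.1 ≠ i.2} =>
        ∼ (Term.equal (Term.var (Sum.inr i.1.1 : Empty ⊕ Fin m)) (Term.var (Sum.inr i.1.2)))))

theorem realize_atLeastSentence [CompatibleRing A] (φ : Language.ring.Formula Unit) (m : ℕ) :
    A ⊨ atLeastSentence φ m ↔
      ∃ f : Fin m → A, (∀ i, φ.Realize fun _ => f i) ∧ Function.Injective f := by
  simp only [Sentence.Realize, atLeastSentence, Formula.realize_iExs, Formula.realize_inf,
    Formula.realize_iInf, Formula.realize_relabel, Formula.realize_not, Formula.realize_equal,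
    Term.realize_var, Sum.elim_inr, Function.comp_def]
  refine exists_congr fun f => and_congr_right fun _ => ?_
  constructor
  · intro h i j hij
    by_contra hne
    exact h ⟨(i, j), hne⟩ hij
  · rintro h ⟨⟨i, j⟩, hne⟩ hij
    exact hne (h hij)

theorem exists_injective_fin_iff_le_ncard {α : Type*} {S : Set α} (hS : S.Finite) (m : ℕ) :
    (∃ f : Fin m → α, (∀ i, f i ∈ S) ∧ Function.Injective f) ↔ m ≤ S.ncard := by
  have := hS.to_subtype
  constructor
  · rintro ⟨f, hf, hinj⟩
    have := Nat.card_le_card_of_injective (fun i => (⟨f i, hf i⟩ : S))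
      fun i j h => hinj (congrArg Subtype.val h)
    rwa [Nat.card_fin] at this
  · intro h
    let e := Finite.equivFin S
    exact ⟨fun i => (e.symm (Fin.castLE h i) : S), fun i => Subtype.coe_prop _,
      Subtype.val_injective.comp (e.symm.injective.comp (Fin.castLE_injective h))⟩

/-- Elementarily equivalent rings have equally many minimal idempotents detecting `p`. -/
theorem RingElementarilyEquivalent.ncard_minimalIdempotent_eq {B : Type*} [CommRing B]
    (h : RingElementarilyEquivalent A B) (p : ℕ)
    (hA : {e : A | IsMinimalIdempotent e ∧ DetectsPrime p e}.Finite)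
    (hB : {e : B | IsMinimalIdempotent e ∧ DetectsPrime p e}.Finite) :
    {e : A | IsMinimalIdempotent e ∧ DetectsPrime p e}.ncard =
      {e : B | IsMinimalIdempotent e ∧ DetectsPrime p e}.ncard := by
  let := compatibleRingOfRing A
  let := compatibleRingOfRing B
  have h : Language.ring.ElementarilyEquivalent A B := h
  have key : ∀ m, m ≤ {e : A | IsMinimalIdempotent e ∧ DetectsPrime p e}.ncard ↔
      m ≤ {e : B | IsMinimalIdempotent e ∧ DetectsPrime p e}.ncard := fun m => by
    rw [← exists_injective_fin_iff_le_ncard hA, ← exists_injective_fin_iff_le_ncard hB]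
    have := elementarilyEquivalent_iff.mp h
      (atLeastSentence (minimalIdempotentFormula ⊓ detectsPrimeFormula p) m)
    simpa only [Set.mem_ofPred_eq, realize_atLeastSentence, Formula.realize_inf,
      realize_detectsPrimeFormula, realize_minimalIdempotentFormula] using this
  exact le_antisymm ((key _).mp le_rfl) ((key _).mpr le_rfl)
end

/-! ### Rings with local components, and squares in complete fields -/

section
/-- A ring `A` embedded in a product of fields `F i` so that its image contains every element
supported at a single index. -/
structure LocalComponents (A : Type*) [CommRing A] {ι : Type*} (F : ι → Type*)
    [∀ i, Field (F i)] where
  /-- The projections to the fields. -/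
  proj : ∀ i, A →+* F i
  /-- The element with a given component at `i` and zero components elsewhere. -/
  single : ∀ i, F i → A
  ext : ∀ a b, (∀ i, proj i a = proj i b) → a = b
  proj_single : ∀ i x, proj i (single i x) = x
  proj_single_of_ne : ∀ i j x, j ≠ i → proj j (single i x) = 0

namespace LocalComponents
variable {A : Type*} [CommRing A] {ι : Type*} {F : ι → Type*} [∀ i, Field (F i)]
variable (c : LocalComponents A F)
include c

theorem single_one_mul (i : ι) (a : A) : c.single i 1 * a = c.single i (c.proj i a) := by
  refine c.ext _ _ fun j => ?_
  rw [map_mul]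
  rcases eq_or_ne j i with rfl | hj
  · rw [c.proj_single, c.proj_single, one_mul]
  · rw [c.proj_single_of_ne i j _ hj, c.proj_single_of_ne i j _ hj, zero_mul]

theorem single_injective (i : ι) : Function.Injective (c.single i) := fun x y h => by
  rw [← c.proj_single i x, h, c.proj_single]

theorem single_zero (i : ι) : c.single i 0 = 0 := by
  have := c.single_one_mul i 0
  rwa [map_zero, mul_zero, eq_comm] at this

theorem single_one_injective : Function.Injective fun i => c.single i 1 := fun i j h => by
  by_contra hne
  have h : c.single i 1 = c.single j 1 := h
  have := c.proj_single i 1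
  rw [h, c.proj_single_of_ne j i 1 hne] at this
  exact zero_ne_one this

/-- The minimal idempotents are the indicators of the individual indices. -/
theorem isMinimalIdempotent_iff (e : A) : IsMinimalIdempotent e ↔ ∃ i, c.single i 1 = e := by
  constructor
  · rintro ⟨hee, he0, hmin⟩
    obtain ⟨i, hi⟩ : ∃ i, c.proj i e ≠ 0 := by
      by_contra! h
      exact he0 (c.ext _ _ fun i => by rw [h, map_zero])
    have h1 : c.proj i e = 1 := by
      have := congrArg (c.proj i) hee
      rw [map_mul] at this
      exact mul_left_cancel₀ hi (this.trans (mul_one _).symm)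
    refine ⟨i, ?_⟩
    have hs : c.single i 1 * e = c.single i 1 := by rw [c.single_one_mul, h1]
    have hss : c.single i 1 * c.single i 1 = c.single i 1 := by
      rw [c.single_one_mul, c.proj_single]
    rcases hmin _ hss with h | h
    · rw [mul_comm, hs, ← c.single_zero i] at h
      exact absurd (c.single_injective i h) one_ne_zero
    · rw [← h, mul_comm, hs]
  · rintro ⟨i, rfl⟩
    refine ⟨by rw [c.single_one_mul, c.proj_single], fun h => ?_, fun f hf => ?_⟩
    · rw [← c.single_zero i] at h
      exact one_ne_zero (c.single_injective i h)
    · rw [c.single_one_mul]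
      have h : c.proj i f * c.proj i f = c.proj i f := by rw [← map_mul, hf]
      rcases IsIdempotentElem.iff_eq_zero_or_one.mp h with h | h
      · exact Or.inl (by rw [h, c.single_zero])
      · exact Or.inr (by rw [h])

theorem oneAddIsSquareAt_single_iff (i : ι) (t x : A) :
    OneAddIsSquareAt (c.single i 1) t x ↔
      OneAddIsSquareAt (1 : F i) (c.proj i t) (c.proj i x) := by
  constructor
  · rintro ⟨z, hz⟩
    refine ⟨c.proj i z, ?_⟩
    simpa [c.proj_single] using congrArg (c.proj i) hz
  · rintro ⟨z, hz⟩
    refine ⟨c.single i z, ?_⟩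
    rw [c.single_one_mul, c.single_one_mul]
    simp only [one_mul] at hz
    simp [c.proj_single, hz]

theorem detectsPrime_single_iff (p : ℕ) (i : ι) :
    DetectsPrime p (c.single i 1) ↔ DetectsPrime p (1 : F i) := by
  have hinv : ∀ x : A, c.single i 1 * (p * x) = c.single i 1 ↔
      (1 : F i) * (p * c.proj i x) = 1 := fun x => by
    rw [c.single_one_mul, (c.single_injective i).eq_iff, map_mul, map_natCast, one_mul]
  constructor
  · rintro ⟨t, hadd, hone, hp⟩
    refine ⟨c.proj i t, fun x y hx hy => ?_, ?_, fun x hx hsq => ?_⟩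
    · rw [← c.proj_single i x] at hx ⊢
      rw [← c.proj_single i y] at hy ⊢
      rw [← map_add]
      rw [← c.oneAddIsSquareAt_single_iff] at hx hy ⊢
      exact hadd _ _ hx hy
    · simpa using (c.oneAddIsSquareAt_single_iff i t 1).mp hone
    · rw [← c.proj_single i x] at hx hsq
      exact hp _ ((hinv _).mpr hx) ((c.oneAddIsSquareAt_single_iff i _ _).mpr hsq)
  · rintro ⟨t, hadd, hone, hp⟩
    refine ⟨c.single i t, fun x y hx hy => ?_, ?_, fun x hx hsq => ?_⟩
    · rw [c.oneAddIsSquareAt_single_iff, c.proj_single] at hx hy ⊢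
      rw [map_add]
      exact hadd _ _ hx hy
    · rw [c.oneAddIsSquareAt_single_iff, c.proj_single, map_one]
      exact hone
    · rw [c.oneAddIsSquareAt_single_iff, c.proj_single] at hsq
      exact hp _ ((hinv x).mp hx) hsq

theorem setOf_minimalIdempotent_eq (p : ℕ) :
    {e : A | IsMinimalIdempotent e ∧ DetectsPrime p e} =
      (fun i => c.single i 1) '' {i | DetectsPrime p (1 : F i)} := by
  ext e
  constructor
  · rintro ⟨he, hp⟩
    obtain ⟨i, rfl⟩ := (c.isMinimalIdempotent_iff e).mp he
    exact ⟨i, (c.detectsPrime_single_iff p i).mp hp, rfl⟩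
  · rintro ⟨i, hi, rfl⟩
    exact ⟨(c.isMinimalIdempotent_iff _).mpr ⟨i, rfl⟩, (c.detectsPrime_single_iff p i).mpr hi⟩

end LocalComponents

theorem DetectsPrime.of_ringEquiv {A B : Type*} [CommRing A] [CommRing B] (f : A ≃+* B) {p : ℕ}
    (h : DetectsPrime p (1 : A)) : DetectsPrime p (1 : B) := by
  have key : ∀ t x : A, OneAddIsSquareAt (1 : A) t x ↔ OneAddIsSquareAt (1 : B) (f t) (f x) := by
    intro t x
    refine ⟨fun ⟨z, hz⟩ => ⟨f z, by simpa using congrArg f hz⟩, fun ⟨z, hz⟩ => ⟨f.symm z, ?_⟩⟩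
    apply f.injective
    simpa using hz
  obtain ⟨t, hadd, hone, hp⟩ := h
  refine ⟨f t, fun x y hx hy => ?_, ?_, fun x hx hsq => ?_⟩
  · obtain ⟨x, rfl⟩ := f.surjective x
    obtain ⟨y, rfl⟩ := f.surjective y
    rw [← map_add, ← key]
    exact hadd x y ((key t x).mpr hx) ((key t y).mpr hy)
  · simpa using (key t 1).mp hone
  · obtain ⟨x, rfl⟩ := f.surjective x
    refine hp x ?_ ((key t x).mpr hsq)
    apply f.injective
    simpa using hx
end

section
variable {F : Type*} [NontriviallyNormedField F] [CompleteSpace F]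

/-- The inverse function theorem for squaring at `1`. -/
theorem isSquare_mem_nhds_one (h2 : (2 : F) ≠ 0) : {y : F | IsSquare y} ∈ 𝓝 (1 : F) := by
  have hd : HasStrictDerivAt (fun z : F => z * z) ((1 : F) * 1 + 1 * 1) 1 :=
    (hasStrictDerivAt_id (1 : F)).mul (hasStrictDerivAt_id (1 : F))
  have hmap := hd.map_nhds_eq (by simpa [one_add_one_eq_two] using h2)
  rw [mul_one] at hmap
  rw [← hmap, mem_map]
  exact univ_mem' fun z => ⟨z, rfl⟩

theorem oneAddIsSquareAt_one_iff {A : Type*} [CommRing A] (t x : A) :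
    OneAddIsSquareAt 1 t x ↔ IsSquare (1 + t * (x * x)) := by
  simp [OneAddIsSquareAt, IsSquare]

/-- The set of all `x` with `1 + t x²` a square is a neighborhood of zero, so if it is an additive
group containing `1`, then it contains everything that integers and multiples of arbitrarily small
elements can reach. -/
theorem not_detectsPrime_of_forall_exists (h2 : (2 : F) ≠ 0) {p : ℕ} (hp : (p : F) ≠ 0)
    (h : ∀ ε > 0, ∃ (n k : ℕ) (y : F), ‖y‖ < ε ∧ (n : F) + k * y = (p : F)⁻¹) :
    ¬ DetectsPrime p (1 : F) := by
  rintro ⟨t, hadd, hone, hinv⟩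
  have hcont : ContinuousAt (fun x : F => 1 + t * (x * x)) 0 := by fun_prop
  have hnhds : {x : F | IsSquare (1 + t * (x * x))} ∈ 𝓝 (0 : F) :=
    hcont (by simpa using isSquare_mem_nhds_one h2)
  obtain ⟨ε, hε, hball⟩ := Metric.mem_nhds_iff.mp hnhds
  obtain ⟨n, k, y, hy, hny⟩ := h ε hε
  have hy : OneAddIsSquareAt 1 t y :=
    (oneAddIsSquareAt_one_iff t y).mpr (hball (by simpa using hy))
  have hzero : OneAddIsSquareAt 1 t (0 : F) := ⟨1, by simp⟩
  have hmul : ∀ (m : ℕ) (z : F), OneAddIsSquareAt 1 t z → OneAddIsSquareAt 1 t (m * z) := by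
    intro m z hz
    induction m with
    | zero => simpa using hzero
    | succ m ih => simpa [add_mul] using hadd _ _ ih hz
  refine hinv (p : F)⁻¹ (by rw [mul_inv_cancel₀ hp, mul_one]) ?_
  rw [← hny]
  exact hadd _ _ (by simpa using hmul n 1 hone) (hmul k y hy)

/-- In `ℝ` and `ℂ` the inverse of `p` is an integer multiple of an arbitrarily small element. -/
theorem not_detectsPrime_of_rclike {F : Type*} [RCLike F] {p : ℕ} (hp : p ≠ 0) :
    ¬ DetectsPrime p (1 : F) := by
  have hp' : (p : F) ≠ 0 := by exact_mod_cast hp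
  refine not_detectsPrime_of_forall_exists two_ne_zero hp' fun ε hε => ?_
  obtain ⟨k, hk⟩ := exists_nat_one_div_lt (mul_pos hε (show (0 : ℝ) < p by positivity))
  have hk0 : ((k + 1 : ℕ) : F) ≠ 0 := by exact_mod_cast k.succ_ne_zero
  refine ⟨0, k + 1, ((k + 1 : ℕ) : F)⁻¹ * (p : F)⁻¹, ?_, ?_⟩
  · rw [norm_mul, norm_inv, norm_inv, RCLike.norm_natCast, RCLike.norm_natCast]
    rw [← div_eq_mul_inv, div_lt_iff₀ (by positivity)]
    simpa using hk
  · rw [mul_inv_cancel_left₀ hk0]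
    simp

variable [IsUltrametricDist F]

/-- In a local field of residue characteristic `q ≠ p`, the integers come arbitrarily close to the
inverse of `p`. -/
theorem not_detectsPrime_of_norm_lt_one (h2 : (2 : F) ≠ 0) {p q : ℕ} (hp : (p : F) ≠ 0)
    (hpq : p.Coprime q) (hq0 : q ≠ 0) (hq : ‖(q : F)‖ < 1) : ¬ DetectsPrime p (1 : F) := by
  refine not_detectsPrime_of_forall_exists h2 hp fun ε hε => ?_
  have hlim : Tendsto (fun k : ℕ => ‖(p : F)⁻¹‖ * ‖(q : F)‖ ^ k) atTop (𝓝 0) := by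
    simpa using (tendsto_pow_atTop_nhds_zero_of_lt_one (norm_nonneg _) hq).const_mul ‖(p : F)⁻¹‖
  obtain ⟨k, hk⟩ := (hlim.eventually (gt_mem_nhds hε)).exists
  -- `a` is an inverse of `p` modulo `q ^ k`
  obtain ⟨a, b, hab⟩ : ∃ (a : ℕ) (b : ℤ), (a : ℤ) * p = 1 + b * q ^ k := by
    obtain ⟨u, w, huw⟩ := (Nat.isCoprime_iff_coprime.mpr (hpq.pow_right k) :
      IsCoprime (p : ℤ) ((q ^ k : ℕ) : ℤ))
    have hQ : ((q ^ k : ℕ) : ℤ) ≠ 0 := by exact_mod_cast pow_ne_zero k hq0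
    refine ⟨(u % (q ^ k : ℕ)).toNat, -w - u / (q ^ k : ℕ) * p, ?_⟩
    rw [Int.toNat_of_nonneg (Int.emod_nonneg u hQ)]
    push_cast at huw ⊢
    linear_combination huw + p * Int.emod_add_mul_ediv u ((q : ℤ) ^ k)
  refine ⟨a, 1, (p : F)⁻¹ * (-(b : F) * q ^ k), ?_, ?_⟩
  · rw [norm_mul, norm_mul, norm_neg, norm_pow]
    refine lt_of_le_of_lt ?_ hk
    gcongr
    exact mul_le_of_le_one_left (by positivity) (IsUltrametricDist.norm_intCast_le_one F b)
  · have hab' : (a : F) * p = 1 + b * q ^ k := by exact_mod_cast congrArg (Int.cast (R := F)) hab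
    field_simp
    rw [Nat.cast_one]
    linear_combination hab'

/-- For an odd prime `p` of norm less than one, the one-units are squares: their `p ^ k`-th powers
tend to `1`, hence are eventually squares, and `p ^ k` is odd. -/
theorem isSquare_one_add_of_norm_lt_one (h2 : (2 : F) ≠ 0) {p : ℕ} (hodd : Odd p)
    (hp : ‖(p : F)‖ < 1) {y : F} (hy : ‖y‖ < 1) : IsSquare (1 + y) := by
  set c := max ‖(p : F)‖ ‖y‖
  have hc0 : 0 ≤ c := le_max_of_le_left (norm_nonneg _)
  have hc1 : c < 1 := max_lt hp hy
  have hone : ∀ a : F, ‖a - 1‖ ≤ 1 → ‖a‖ ≤ 1 := fun a ha => by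
    have := IsUltrametricDist.norm_add_le_max (a - 1) 1
    rw [sub_add_cancel, norm_one] at this
    exact this.trans (max_le ha le_rfl)
  have hgeom : ∀ (a : F) (n : ℕ), ‖a - 1‖ ≤ c → ‖a ^ n - 1‖ ≤ c := by
    intro a n ha
    rw [← geom_sum_mul, norm_mul]
    refine (mul_le_of_le_one_left (norm_nonneg _) ?_).trans ha
    refine IsUltrametricDist.norm_sum_le_of_forall_le_of_nonneg zero_le_one fun i _ => ?_
    rw [norm_pow]
    exact pow_le_one₀ (norm_nonneg _) (hone a (ha.trans hc1.le))
  -- `1 + a + ⋯ + a ^ (p - 1)` is congruent to `p` modulo elements of norm at most `c`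
  have hstep : ∀ a : F, ‖a - 1‖ ≤ c → ‖a ^ p - 1‖ ≤ c * ‖a - 1‖ := by
    intro a ha
    rw [← geom_sum_mul, norm_mul]
    refine mul_le_mul_of_nonneg_right ?_ (norm_nonneg _)
    have hsum : ∑ i ∈ Finset.range p, a ^ i = ∑ i ∈ Finset.range p, (a ^ i - 1) + p := by
      simp
    rw [hsum]
    refine (IsUltrametricDist.norm_add_le_max _ _).trans (max_le ?_ (le_max_left _ _))
    exact IsUltrametricDist.norm_sum_le_of_forall_le_of_nonneg hc0 fun i _ => hgeom a i ha
  have hpow : ∀ k : ℕ, ‖(1 + y) ^ p ^ k - 1‖ ≤ c ^ (k + 1) := by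
    intro k
    induction k with
    | zero => simp [c]
    | succ k ih =>
      rw [pow_succ p, pow_mul]
      refine (hstep _ (ih.trans (pow_le_of_le_one hc0 hc1.le k.succ_ne_zero))).trans ?_
      rw [pow_succ' c (k + 1)]
      exact mul_le_mul_of_nonneg_left ih hc0
  have hlim : Tendsto (fun k : ℕ => (1 + y) ^ p ^ k) atTop (𝓝 1) := by
    rw [tendsto_iff_norm_sub_tendsto_zero]
    refine squeeze_zero (fun _ => norm_nonneg _) hpow ?_
    exact (tendsto_pow_atTop_nhds_zero_of_lt_one hc0 hc1).comp (tendsto_add_atTop_nat 1)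
  obtain ⟨k, w, hw⟩ := (hlim.eventually (isSquare_mem_nhds_one h2)).exists
  obtain ⟨m, hm⟩ : Odd (p ^ k) := hodd.pow
  have hy0 : (1 + y) ≠ 0 := fun h => by
    rw [eq_neg_of_add_eq_zero_right h, norm_neg, norm_one] at hy
    exact lt_irrefl _ hy
  refine ⟨w / (1 + y) ^ m, ?_⟩
  rw [hm] at hw
  field_simp
  rw [pow_two w, ← hw]
  ring
end

/-! ### The adele ring -/

section
variable {K : Type*} [Field K] [NumberField K]

open scoped Valued in
/-- Completeness for the norm defined by the valuation, whose uniform structure is that of the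
completion by definition. -/
theorem completeSpace_adicCompletion (v : HeightOneSpectrum (𝓞 K)) :
    @CompleteSpace (v.adicCompletion K)
      (Valued.toNontriviallyNormedField (v.adicCompletion K)
        (WithZero (Multiplicative ℤ))).toMetricSpace.toUniformSpace :=
  HeightOneSpectrum.adicCompletion.instCompleteSpace K v

open scoped Valued in
/-- For a uniformizer `t` at an odd place, `1 + t x²` is a square precisely for integral `x`: when
`x` is not integral, its valuation is odd. -/
theorem isSquare_one_add_uniformizer_mul_iff (v : HeightOneSpectrum (𝓞 K)) {p : ℕ} (hodd : Odd p)
    (hp : ‖(p : v.adicCompletion K)‖ < 1) (h2 : (2 : v.adicCompletion K) ≠ 0)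
    {t : v.adicCompletion K} (ht : Valued.v t = WithZero.exp (-1 : ℤ)) (x : v.adicCompletion K) :
    IsSquare (1 + t * (x * x)) ↔ Valued.v x ≤ 1 := by
  have ht1 : Valued.v t < 1 := by rw [ht, ← WithZero.exp_zero, WithZero.exp_lt_exp]; norm_num
  constructor
  · rintro ⟨z, hz⟩
    by_contra! hx
    have hx0 : Valued.v x ≠ 0 := (zero_lt_one.trans hx).ne'
    obtain ⟨k, hk⟩ : ∃ k : ℤ, Valued.v x = WithZero.exp k := ⟨_, (WithZero.exp_log hx0).symm⟩
    have hk0 : 0 < k := by rwa [hk, ← WithZero.exp_zero, WithZero.exp_lt_exp] at hx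
    have hval : Valued.v (t * (x * x)) = WithZero.exp (2 * k - 1) := by
      rw [map_mul, map_mul, ht, hk, ← WithZero.exp_add, ← WithZero.exp_add]
      congr 1; ring
    have hgt : Valued.v (1 : v.adicCompletion K) < Valued.v (t * (x * x)) := by
      rw [hval, map_one, ← WithZero.exp_zero, WithZero.exp_lt_exp]; omega
    have heq := Valuation.map_add_eq_of_lt_right Valued.v hgt
    rw [hz, map_mul, hval] at heq
    have hz0 : Valued.v z ≠ 0 := fun h => by
      rw [h, zero_mul] at heq
      exact WithZero.exp_ne_zero heq.symm
    obtain ⟨l, hl⟩ : ∃ l : ℤ, Valued.v z = WithZero.exp l := ⟨_, (WithZero.exp_log hz0).symm⟩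
    rw [hl, ← WithZero.exp_add, WithZero.exp_inj] at heq
    omega
  · intro hx
    have hy : Valued.v (t * (x * x)) < 1 := by
      rw [map_mul, map_mul]
      exact mul_lt_one_of_lt_of_le ht1 (mul_le_one' hx hx)
    have := completeSpace_adicCompletion v
    exact isSquare_one_add_of_norm_lt_one h2 hodd hp (Valued.toNormedField.norm_lt_one_iff.mpr hy)

theorem valued_natCast_lt_one_iff (v : HeightOneSpectrum (𝓞 K)) (n : ℕ) :
    Valued.v (n : v.adicCompletion K) < 1 ↔ (n : 𝓞 K) ∈ v.asIdeal := by
  rw [← HeightOneSpectrum.valuation_lt_one_iff_mem (K := K) v,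
    ← map_natCast (algebraMap K (v.adicCompletion K)),
    ← HeightOneSpectrum.valuedAdicCompletion_eq_valuation']
  rfl

theorem natCast_adicCompletion_ne_zero (v : HeightOneSpectrum (𝓞 K)) {n : ℕ} (hn : n ≠ 0) :
    (n : v.adicCompletion K) ≠ 0 := by
  rw [← map_natCast (algebraMap K (v.adicCompletion K)), map_ne_zero]
  exact_mod_cast hn

open scoped Valued in
/-- At an odd prime `p`, the first-order condition recognizes the places above `p`. -/
theorem detectsPrime_adicCompletion_iff (v : HeightOneSpectrum (𝓞 K)) {p : ℕ} (hp : p.Prime)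
    (hodd : Odd p) : DetectsPrime p (1 : v.adicCompletion K) ↔ (p : 𝓞 K) ∈ v.asIdeal := by
  have h2 : (2 : v.adicCompletion K) ≠ 0 := by
    exact_mod_cast natCast_adicCompletion_ne_zero v two_ne_zero
  have hp0 := natCast_adicCompletion_ne_zero v hp.ne_zero
  have := completeSpace_adicCompletion v
  have hnorm : ∀ n : ℕ, ‖(n : v.adicCompletion K)‖ < 1 ↔ (n : 𝓞 K) ∈ v.asIdeal := fun n => by
    rw [← valued_natCast_lt_one_iff]
    exact Valued.toNormedField.norm_lt_one_iff
  constructor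
  · intro h
    by_contra hpv
    obtain ⟨q, hq⟩ := exists_mem_placesAbove v
    have hpq : p.Coprime q := (Nat.coprime_primes hp q.2).mpr fun h => hpv (by
      rw [h]; exact mem_placesAbove.mp hq)
    exact not_detectsPrime_of_norm_lt_one h2 hp0 hpq q.2.ne_zero
      ((hnorm q).mpr (mem_placesAbove.mp hq)) h
  · intro hpv
    have hpn := (hnorm p).mpr hpv
    -- the uniformizer `ϖ` is the witness: the set it defines is the valuation ring
    obtain ⟨ϖ, hϖ⟩ := v.valuation_exists_uniformizer K
    have key : ∀ x : v.adicCompletion K, OneAddIsSquareAt 1 (algebraMap K _ ϖ) x ↔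
        Valued.v x ≤ 1 := fun x => by
      rw [oneAddIsSquareAt_one_iff]
      refine isSquare_one_add_uniformizer_mul_iff v hodd hpn h2 ?_ x
      rw [← hϖ]
      exact HeightOneSpectrum.valuedAdicCompletion_eq_valuation' v ϖ
    refine ⟨algebraMap K _ ϖ, fun x y hx hy => ?_, ?_, fun x hx hsq => ?_⟩
    · rw [key] at hx hy ⊢
      exact (Valuation.map_add _ _ _).trans (max_le hx hy)
    · rw [key, map_one]
    · rw [key] at hsq
      rw [one_mul] at hx
      have := congrArg Valued.v hx
      rw [map_mul, map_one] at this
      exact absurd this (mul_lt_one_of_lt_of_le ((valued_natCast_lt_one_iff v p).mpr hpv) hsq).ne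

/-- An archimedean completion never satisfies the first-order condition. -/
theorem not_detectsPrime_infinitePlace {K : Type*} [Field K] (w : InfinitePlace K) {p : ℕ}
    (hp : p ≠ 0) : ¬ DetectsPrime p (1 : w.Completion) := by
  intro h
  rcases w.isReal_or_isComplex with hw | hw
  · exact not_detectsPrime_of_rclike hp
      (h.of_ringEquiv (InfinitePlace.Completion.ringEquivRealOfIsReal hw))
  · exact not_detectsPrime_of_rclike hp
      (h.of_ringEquiv (InfinitePlace.Completion.ringEquivComplexOfIsComplex hw))

variable (K) in
/-- The completion of `K` at a place. -/
def placeCompletion : InfinitePlace K ⊕ HeightOneSpectrum (𝓞 K) → Type _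
  | .inl w => w.Completion
  | .inr v => v.adicCompletion K

noncomputable instance (u : InfinitePlace K ⊕ HeightOneSpectrum (𝓞 K)) :
    Field (placeCompletion K u) :=
  match u with
  | .inl w => inferInstanceAs (Field w.Completion)
  | .inr v => inferInstanceAs (Field (v.adicCompletion K))

open scoped Classical in
/-- The adele ring as a ring of families indexed by the places. -/
noncomputable def adeleLocalComponents (K : Type*) [Field K] [NumberField K] :
    LocalComponents (AdeleRing (𝓞 K) K) (placeCompletion K) where
  proj
    | .inl w => (Pi.evalRingHom (fun w : InfinitePlace K => w.Completion) w).comp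
        (RingHom.fst (InfiniteAdeleRing K) (FiniteAdeleRing (𝓞 K) K))
    | .inr v => (RestrictedProduct.evalRingHom
        (fun v : HeightOneSpectrum (𝓞 K) => v.adicCompletion K) v).comp
        (RingHom.snd (InfiniteAdeleRing K) (FiniteAdeleRing (𝓞 K) K))
  single
    | .inl w => fun x => ((Pi.single w x : InfiniteAdeleRing K), 0)
    | .inr v => fun x => (0, RestrictedProduct.single _ v x)
  ext a b h := by
    refine Prod.ext (funext fun w => h (.inl w)) (FiniteAdeleRing.ext K fun v => h (.inr v))
  proj_single := by
    rintro (w | v) x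
    · exact Pi.single_eq_same w x
    · exact RestrictedProduct.single_eq_same
        (fun v : HeightOneSpectrum (𝓞 K) => v.adicCompletionIntegers K) v x
  proj_single_of_ne := by
    rintro (w | v) (w' | v') x hne
    · exact Pi.single_eq_of_ne (fun h => hne (congrArg _ h)) x
    · rfl
    · rfl
    · have hv : v' ≠ v := fun h => hne (congrArg _ h)
      exact RestrictedProduct.single_eq_of_ne
        (fun v : HeightOneSpectrum (𝓞 K) => v.adicCompletionIntegers K) x hv

theorem setOf_detectsPrime_eq (p : Nat.Primes) (hodd : Odd (p : ℕ)) :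
    {u | DetectsPrime (p : ℕ) (1 : placeCompletion K u)} =
      Sum.inr '' (placesAbove K p : Set (HeightOneSpectrum (𝓞 K))) := by
  ext (w | v)
  · refine iff_of_false (not_detectsPrime_infinitePlace w p.2.ne_zero) ?_
    simp
  · rw [Set.mem_image]
    simp only [Sum.inr.injEq, exists_eq_right, Finset.mem_coe, mem_placesAbove]
    exact detectsPrime_adicCompletion_iff v p.2 hodd

/-- For an odd prime `p`, the number of primes above `p` is visible in the first-order theory of
the adele ring. -/
theorem finite_and_ncard_minimalIdempotent_adeleRing (K : Type*) [Field K] [NumberField K]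
    (p : Nat.Primes) (hodd : Odd (p : ℕ)) :
    {e : AdeleRing (𝓞 K) K | IsMinimalIdempotent e ∧ DetectsPrime (p : ℕ) e}.Finite ∧
      {e : AdeleRing (𝓞 K) K | IsMinimalIdempotent e ∧ DetectsPrime (p : ℕ) e}.ncard =
        primesAboveCard K p := by
  rw [(adeleLocalComponents K).setOf_minimalIdempotent_eq, setOf_detectsPrime_eq p hodd]
  refine ⟨((Finset.finite_toSet _).image _).image _, ?_⟩
  rw [Set.ncard_image_of_injective _ (adeleLocalComponents K).single_one_injective,
    Set.ncard_image_of_injective _ Sum.inr_injective, Set.ncard_coe_finset,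
    card_placesAbove]

/-- Only the prime `2` is left undetermined. -/
theorem primesAboveCardEquivalent_of_ringElementarilyEquivalent {L : Type*} [Field L]
    [NumberField L] (h : RingElementarilyEquivalent (AdeleRing (𝓞 K) K) (AdeleRing (𝓞 L) L)) :
    PrimesAboveCardEquivalent K L := by
  refine Set.Finite.subset (Set.finite_singleton (⟨2, Nat.prime_two⟩ : Nat.Primes)) ?_
  intro p hne
  by_contra hp2
  refine hne ?_
  have hodd : Odd (p : ℕ) := p.2.odd_of_ne_two fun h => hp2 (Subtype.ext h)
  obtain ⟨hK, hK'⟩ := finite_and_ncard_minimalIdempotent_adeleRing K p hodd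
  obtain ⟨hL, hL'⟩ := finite_and_ncard_minimalIdempotent_adeleRing L p hodd
  rw [← hK', ← hL']
  exact h.ncard_minimalIdempotent_eq p hK hL
end

theorem mainTheorem4 (K : Type*) [Field K] [NumberField K] :
    (∃ S : Set (IntermediateField ℚ (AlgebraicClosure ℚ)), S.Finite ∧
      ∀ (L : Type*) [Field L] [NumberField L],
        RingElementarilyEquivalent
          (NumberField.AdeleRing (NumberField.RingOfIntegers K) K)
          (NumberField.AdeleRing (NumberField.RingOfIntegers L) L) →
        ∃ F ∈ S, Nonempty (L ≃+* F)) ∧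
    (∃ S : Set (IntermediateField ℚ (AlgebraicClosure ℚ)), S.Finite ∧
      ∀ (L : Type*) [Field L] [NumberField L],
        ArithmeticallyEquivalent K L → ∃ F ∈ S, Nonempty (L ≃+* F)) := by
  have := isAlgebraic_rat_algebraicClosure
  have hfin := finite_setOf_le_normalClosure K (AlgebraicClosure ℚ)
  exact ⟨⟨_, hfin, fun L _ _ h =>
      (primesAboveCardEquivalent_of_ringElementarilyEquivalent h).exists_ringEquiv⟩,
    ⟨_, hfin, fun L _ _ h => h.primesAboveCardEquivalent.exists_ringEquiv⟩⟩
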